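/- Let $d\ge 1$, let $A=\Delta^2$ on $\mathbb{R}^d$, and for $t>0$ let $G(t,\cdot)$ be the function on $\mathbb{R}^d$ with Fourier transform $\widehat G(t,\xi)=\int_{\mathbb{R}^d} e^{-i x\cdot\xi}G(t,x)\,dx=e^{-t|\xi|^4}$. For a function $k:\mathbb{R}^d\to\mathbb{R}$ such that for every $t>0$ the convolution $G(t,\cdot)\star k$ converges absolutely at every point, put $e^{-tA}k:=G(t,\cdot)\star k$ and define, with values in $[0,\infty]$, \[ \|k\|_{\mathcal B}:=\sup_{t>0} t^{1/4}\|\nabla e^{-tA}k\|_{L^\infty},\qquad \|k\|_{\mathcal B^0}:=\Bigl(\sup_{x\in\mathbb{R}^d,\,r>0}\frac1{r^{d+2}}\int_0^{r^4}\!\!\int_{B_r(x)}|\nabla e^{-tA}k(y)|^2\,dy\,dt\Bigr)^{1/2}, \] and, for $R>0$, let $\|k\|_{\mathcal B_R}$ and $\|k\|_{\mathcal B^0_R}$ be given by the same formulas with the suprema restricted to $0<t\le R^4$ and to $x\in\mathbb{R}^d$, $0<r\le R$, respectively. Let $\mathcal B^0$ be the space of all such $k$ for which $e^{-tA}k$ is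 differentiable in $x$ for every $t>0$, $|\nabla e^{-tA}k|\in L^2_{\mathrm{loc}}((0,\infty)\times\mathbb{R}^d)$ and $\|k\|_{\mathcal B^0}<\infty$. For $k\in L^1_{\mathrm{loc}}(\mathbb{R}^d)$ let $\|k\|_{BMO}:=\sup_{B}\frac1{|B|}\int_B|k-k_B|\,dy$, where $B$ runs over all balls and $k_B:=\frac1{|B|}\int_B k\,dy$, and let $BMO(\mathbb{R}^d)$ be the space of all $k\in L^1_{\mathrm{loc}}(\mathbb{R}^d)$ with $\|k\|_{BMO}<\infty$. (a) If $d\le 3$, there are constants $c_1,c_2>0$, depending only on $d$, such that for every $k$ as above \[ c_1\|k\|_{\mathcal B}\le\|k\|_{\mathcal B^0}\le c_2\|k\|_{\mathcal B} \qquad\text{and}\qquad c_1\|k\|_{\mathcal B_R}\le\|k\|_{\mathcal B^0_R}\le c_2\|k\|_{\mathcal B_R}\quad\text{for every } R>0. \] (b) For every $d\ge1$ there is a constant $c_3>0$, depending only on $d$, such that $\|k\|_{\mathcal B^0}\le c_3\|k\|_{BMO}$ for every $k\in BMO(\mathbb{R}^d)$. Moreover $BMO(\mathbb{R}^d)\subset\mathcal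 B^0$, and in particular $L^\infty(\mathbb{R}^d)\subset\mathcal B^0$. -/

import Mathlib

open MeasureTheory Set
open scoped ENNReal NNReal FourierTransform

noncomputable section

namespace Bicaloric

/-- The Euclidean space `ℝ^d`. -/
abbrev E (d : ℕ) : Type := EuclideanSpace ℝ (Fin d)

/-- The Green's function of `∂ₜ + Δ²`: the function whose Fourier transform in `x`, with the
convention `∫ exp (-i x·ξ) f x dx`, is `exp (-t |ξ|⁴)`. Mathlib's Fourier transform is
`∫ exp (-2πi x·ξ) f x dx`, hence `2πξ` in place of `ξ`. The inverse transform is real, since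
the symbol is real and even. -/
def green (d : ℕ) (t : ℝ) (x : E d) : ℝ :=
  (𝓕⁻ (fun ξ : E d => ((Real.exp (-t * (2 * Real.pi * ‖ξ‖) ^ 4) : ℝ) : ℂ)) x).re

/-- The bi-caloric extension is defined: for every `t > 0` the convolution `G(t,·) ⋆ k`
converges absolutely at every point. -/
def HasExtension {d : ℕ} (k : E d → ℝ) : Prop :=
  ∀ t : ℝ, 0 < t →
    ConvolutionExists (green d t) k (ContinuousLinearMap.lsmul ℝ ℝ) volume

/-- The bi-caloric extension `(t, x) ↦ (e^{-tA} k)(x) = (G(t,·) ⋆ k)(x)`, `A = Δ²`. -/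
def extension {d : ℕ} (k : E d → ℝ) (t : ℝ) : E d → ℝ :=
  convolution (green d t) k (ContinuousLinearMap.lsmul ℝ ℝ) volume

/-- The quantity `r^{-(d+2)} ∫₀^{r⁴} ∫_{B_r(x)} |∇h|² dy dt`. -/
def energy {d : ℕ} (h : ℝ → E d → ℝ) (x : E d) (r : ℝ) : ℝ≥0∞ :=
  (∫⁻ t in Ioo 0 (r ^ 4), ∫⁻ y in Metric.ball x r, ‖gradient (h t) y‖ₑ ^ 2) /
    ENNReal.ofReal (r ^ (d + 2))

/-- The seminorm of `𝒳⁰`, with values in `[0, ∞]`. -/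
def normX0 {d : ℕ} (h : ℝ → E d → ℝ) : ℝ≥0∞ :=
  (⨆ (x : E d) (r : ℝ) (_ : 0 < r), energy h x r) ^ (1 / 2 : ℝ)

/-- The seminorm of `𝒳⁰_R`. -/
def normX0Loc {d : ℕ} (R : ℝ) (h : ℝ → E d → ℝ) : ℝ≥0∞ :=
  (⨆ (x : E d) (r : ℝ) (_ : 0 < r ∧ r ≤ R), energy h x r) ^ (1 / 2 : ℝ)

/-- The quantity `t^{1/4} ‖∇h(t)‖_∞`. -/
def weightedGrad {d : ℕ} (h : ℝ → E d → ℝ) (t : ℝ) : ℝ≥0∞ :=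
  ENNReal.ofReal (t ^ (1 / 4 : ℝ)) * eLpNorm (fun x => gradient (h t) x) ∞ volume

/-- The seminorm of `𝒳`. -/
def normX {d : ℕ} (h : ℝ → E d → ℝ) : ℝ≥0∞ :=
  ⨆ (t : ℝ) (_ : 0 < t), weightedGrad h t

/-- The seminorm of `𝒳_R`. -/
def normXLoc {d : ℕ} (R : ℝ) (h : ℝ → E d → ℝ) : ℝ≥0∞ :=
  ⨆ (t : ℝ) (_ : 0 < t ∧ t ≤ R ^ 4), weightedGrad h t

/-- `‖k‖_{𝓑⁰}`. -/
def normB0 {d : ℕ} (k : E d → ℝ) : ℝ≥0∞ := normX0 (extension k)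

/-- `‖k‖_{𝓑⁰_R}`. -/
def normB0Loc {d : ℕ} (R : ℝ) (k : E d → ℝ) : ℝ≥0∞ := normX0Loc R (extension k)

/-- `‖k‖_𝓑`. -/
def normB {d : ℕ} (k : E d → ℝ) : ℝ≥0∞ := normX (extension k)

/-- `‖k‖_{𝓑_R}`. -/
def normBLoc {d : ℕ} (R : ℝ) (k : E d → ℝ) : ℝ≥0∞ := normXLoc R (extension k)

/-- `k ∈ 𝓑⁰`: the bi-caloric extension is defined, has (classical) spatial derivatives with
`|∇h| ∈ L²_loc((0,∞) × ℝ^d)`, and its `𝒳⁰` seminorm is finite. -/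
def MemB0 {d : ℕ} (k : E d → ℝ) : Prop :=
  HasExtension k ∧
    (∀ t : ℝ, 0 < t → Differentiable ℝ (extension k t)) ∧
    LocallyIntegrableOn (fun p : ℝ × E d => ‖gradient (extension k p.1) p.2‖ ^ 2)
      (Ioi 0 ×ˢ univ) ∧
    normB0 k < ∞

/-- The `BMO` seminorm of a locally integrable function: the supremum over all balls of the
mean oscillation. -/
def normBMO {d : ℕ} (k : E d → ℝ) : ℝ≥0∞ :=
  ⨆ (x : E d) (r : ℝ) (_ : 0 < r),
    (∫⁻ y in Metric.ball x r, ‖k y - ⨍ z in Metric.ball x r, k z‖ₑ) / volume (Metric.ball x r)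

/-- `k ∈ BMO(ℝ^d)`. -/
def MemBMO {d : ℕ} (k : E d → ℝ) : Prop :=
  LocallyIntegrable k ∧ normBMO k < ∞

end Bicaloric

end

/-!
Shifting the contour in the Fourier integral of `G(1, ·)` gives `|G(1, x)| ≤ C e^{-c|x|^{4/3}}`, and
a Landau inequality transfers such a bound to the gradient; by scaling, `G(r⁴, ·)` and
`r |∇G(r⁴, ·)|` are dominated by the approximate identity `r^{-d} (1 + |x| / r)^{-(d+1)}`.

The decay rate cannot be improved: on the Fourier side one reads off `4 ∇ΔG = x G` at time `1`,
which for radial functions is a third-order equation, and a weighted energy of it decays no faster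
than `e^{-K|x|^{4/3}}`. Hence absolute convergence of `G(t, ·) ⋆ k` for all `t > 0`, made uniform in
the base point by Baire's theorem and rescaled in time, forces `k` to be integrable against every
weight `e^{-c|x|^{4/3}}`. Differentiation under the integral and the semigroup law follow.

For the seminorms, `∇h(r⁴) = G(r⁴ - s) ⋆ ∇h(s)` is averaged over `0 < s < r⁴ / 2`, and the
Cauchy–Schwarz inequality on each parabolic cylinder bounds `r |∇h(r⁴)|` by the `𝓑⁰` seminorm; this
uses no restriction on `d`. Conversely `∫₀^{r⁴} t^{-1/2} dt = 2 r²`. For `BMO`, `∇G` has integral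
zero, so the mean of `k` over a ball may be subtracted, and the oscillation over the dyadic dilates
of the ball grows only linearly in the scale.
-/

noncomputable section

namespace Bicaloric

section Symbol

open scoped SchwartzMap

lemma abs_pow_mul_exp_neg_sq_half_le (m : ℕ) (x : ℝ) :
    |x| ^ m * Real.exp (-(x ^ 2 / 2)) ≤ m.factorial * Real.exp (1 / 2) := by
  have hpow : |x| ^ m ≤ Real.exp |x| * m.factorial :=
    (div_le_iff₀ (by positivity)).1 (Real.pow_div_factorial_le_exp |x| (abs_nonneg x) m)
  calc |x| ^ m * Real.exp (-(x ^ 2 / 2))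
      ≤ Real.exp |x| * m.factorial * Real.exp (-(x ^ 2 / 2)) := by gcongr
    _ = m.factorial * Real.exp (|x| + -(x ^ 2 / 2)) := by rw [Real.exp_add]; ring
    _ ≤ m.factorial * Real.exp (1 / 2) := by
        gcongr
        nlinarith [sq_nonneg (|x| - 1), sq_abs x]

lemma exists_abs_eval_mul_exp_neg_sq_half_le (p : Polynomial ℝ) :
    ∃ C : ℝ, ∀ x : ℝ, |p.eval x * Real.exp (-(x ^ 2 / 2))| ≤ C := by
  induction p using Polynomial.induction_on' with
  | add p q hp hq =>
    obtain ⟨Cp, hCp⟩ := hp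
    obtain ⟨Cq, hCq⟩ := hq
    refine ⟨Cp + Cq, fun x => ?_⟩
    rw [Polynomial.eval_add, add_mul]
    exact (abs_add_le _ _).trans (add_le_add (hCp x) (hCq x))
  | monomial n a =>
    refine ⟨|a| * (n.factorial * Real.exp (1 / 2)), fun x => ?_⟩
    rw [Polynomial.eval_monomial, abs_mul, abs_mul, abs_pow, Real.abs_exp, mul_assoc]
    exact mul_le_mul_of_nonneg_left (abs_pow_mul_exp_neg_sq_half_le n x) (abs_nonneg a)

/-- The Gaussian `x ↦ exp (-x² / 2)` as a Schwartz function on the line. -/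
def gaussianSchwartz : 𝓢(ℝ, ℝ) where
  toFun x := Real.exp (-(x ^ 2 / 2))
  smooth' := by fun_prop
  decay' k n := by
    obtain ⟨C, hC⟩ := exists_abs_eval_mul_exp_neg_sq_half_le
      (Polynomial.X ^ k * (Polynomial.hermite n).map (Int.castRingHom ℝ))
    refine ⟨C, fun x => le_of_eq_of_le ?_ (hC x)⟩
    rw [norm_iteratedFDeriv_eq_norm_iteratedDeriv, iteratedDeriv_eq_iterate,
      Polynomial.deriv_gaussian_eq_hermite_mul_gaussian, Polynomial.aeval_def,
      algebraMap_int_eq, ← Polynomial.eval_map]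
    simp [mul_assoc]

lemma norm_le_mul_one_add_norm_mul_norm_sq {V : Type*} [SeminormedAddGroup V] {b : ℝ} (hb : 0 < b)
    (ξ : V) :
    ‖ξ‖ ≤ (1 + 1 / b) * (1 + ‖b * ‖ξ‖ ^ 2‖) ^ 1 := by
  rw [pow_one, Real.norm_of_nonneg (by positivity)]
  have expand : (1 + 1 / b) * (1 + b * ‖ξ‖ ^ 2) = 1 + 1 / b + b * ‖ξ‖ ^ 2 + ‖ξ‖ ^ 2 := by
    field_simp
    ring
  have : 0 < 1 / b := by positivity
  have : 0 ≤ b * ‖ξ‖ ^ 2 := by positivity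
  nlinarith [sq_nonneg (‖ξ‖ - 1)]

section InnerProductSpace

variable {V : Type*} [NormedAddCommGroup V] [InnerProductSpace ℝ V]

variable (V) in
/-- The function `ξ ↦ exp (-a ‖ξ‖⁴)` as a Schwartz function: the Gaussian composed with
`ξ ↦ √(2 a) ‖ξ‖²`. -/
def expNegQuartic {a : ℝ} (ha : 0 < a) : 𝓢(V, ℂ) :=
  (SchwartzMap.compCLM ℝ (g := fun ξ : V => √(2 * a) * ‖ξ‖ ^ 2) (by fun_prop)
    ⟨1, _, norm_le_mul_one_add_norm_mul_norm_sq (Real.sqrt_pos.2 (by positivity))⟩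
    gaussianSchwartz).postcompCLM Complex.ofRealCLM

lemma expNegQuartic_apply {a : ℝ} (ha : 0 < a) (ξ : V) :
    expNegQuartic V ha ξ = (Real.exp (-a * ‖ξ‖ ^ 4) : ℝ) := by
  rw [expNegQuartic, SchwartzMap.postcompCLM_apply, SchwartzMap.compCLM_apply]
  change ((Real.exp (-((√(2 * a) * ‖ξ‖ ^ 2) ^ 2 / 2)) : ℝ) : ℂ) = _
  congr 2
  rw [mul_pow, Real.sq_sqrt (by positivity)]
  ring

lemma integrable_exp_neg_mul_norm_pow_four [MeasurableSpace V] [BorelSpace V]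
    [SecondCountableTopology V] (μ : Measure V) [μ.HasTemperateGrowth] {a : ℝ} (ha : 0 < a) :
    Integrable (fun ξ : V => Real.exp (-a * ‖ξ‖ ^ 4)) μ := by
  simpa only [expNegQuartic_apply] using! ((expNegQuartic V ha).integrable (μ := μ)).re

end InnerProductSpace

end Symbol

section Kernel

open scoped SchwartzMap

variable {d : ℕ}

/-- The Fourier symbol `exp (-t (2π‖ξ‖)⁴)` of `e^{-tΔ²}` as a Schwartz function. -/
def symbol (d : ℕ) {t : ℝ} (ht : 0 < t) : 𝓢(E d, ℂ) :=
  expNegQuartic (E d) (a := t * (2 * Real.pi) ^ 4) (by positivity)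

lemma symbol_apply {t : ℝ} (ht : 0 < t) (ξ : E d) :
    symbol d ht ξ = (Real.exp (-t * (2 * Real.pi * ‖ξ‖) ^ 4) : ℝ) := by
  rw [symbol, expNegQuartic_apply]
  congr 2
  ring

/-- The kernel `G(t, ·)` as a complex-valued Schwartz function. -/
def greenSchwartz (d : ℕ) {t : ℝ} (ht : 0 < t) : 𝓢(E d, ℂ) := 𝓕⁻ (symbol d ht)

lemma greenSchwartz_eq_fourierInv {t : ℝ} (ht : 0 < t) (x : E d) :
    greenSchwartz d ht x =
      𝓕⁻ (fun ξ : E d => ((Real.exp (-t * (2 * Real.pi * ‖ξ‖) ^ 4) : ℝ) : ℂ)) x := by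
  rw [greenSchwartz, SchwartzMap.fourierInv_coe]
  exact congrArg (fun f : E d → ℂ => 𝓕⁻ f x) (funext (symbol_apply ht))

lemma green_eq_re {t : ℝ} (ht : 0 < t) (x : E d) : green d t x = (greenSchwartz d ht x).re := by
  rw [greenSchwartz_eq_fourierInv, green]

lemma greenSchwartz_eq_ofReal {t : ℝ} (ht : 0 < t) (x : E d) :
    greenSchwartz d ht x = green d t x := by
  rw [green_eq_re ht]
  refine (Complex.conj_eq_iff_re.1 ?_).symm
  rw [greenSchwartz_eq_fourierInv, Real.fourierInv_eq', ← integral_conj, ← integral_neg_eq_self]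
  congr 1
  ext ξ
  simp [← Complex.exp_conj, inner_neg_left, map_ofNat]

/-- The kernel `G(t, ·)` as a real-valued Schwartz function. -/
def greenReal (d : ℕ) {t : ℝ} (ht : 0 < t) : 𝓢(E d, ℝ) :=
  (greenSchwartz d ht).postcompCLM Complex.reCLM

lemma coe_greenReal {t : ℝ} (ht : 0 < t) : (greenReal d ht : E d → ℝ) = green d t := by
  ext x
  rw [greenReal, SchwartzMap.postcompCLM_apply, green_eq_re ht]
  rfl

lemma contDiff_green {t : ℝ} (ht : 0 < t) (n : ℕ∞) : ContDiff ℝ n (green d t) :=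
  coe_greenReal (d := d) ht ▸ (greenReal d ht).smooth n

lemma differentiable_green {t : ℝ} (ht : 0 < t) : Differentiable ℝ (green d t) :=
  (contDiff_green ht 1).differentiable (by norm_num)

lemma continuous_green {t : ℝ} (ht : 0 < t) : Continuous (green d t) :=
  (differentiable_green ht).continuous

lemma integrable_green {t : ℝ} (ht : 0 < t) : Integrable (green d t) :=
  coe_greenReal (d := d) ht ▸ (greenReal d ht).integrable

lemma coe_fderivCLM_greenReal {t : ℝ} (ht : 0 < t) :
    (SchwartzMap.fderivCLM ℝ (E d) ℝ (greenReal d ht) : E d → E d →L[ℝ] ℝ) =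
      fderiv ℝ (green d t) := by
  ext1 x
  rw [SchwartzMap.fderivCLM_apply, coe_greenReal]

lemma integrable_fderiv_green {t : ℝ} (ht : 0 < t) : Integrable (fderiv ℝ (green d t)) :=
  coe_fderivCLM_greenReal (d := d) ht ▸ SchwartzMap.integrable _

lemma continuous_fderiv_green {t : ℝ} (ht : 0 < t) : Continuous (fderiv ℝ (green d t)) :=
  coe_fderivCLM_greenReal (d := d) ht ▸ SchwartzMap.continuous _

lemma exists_lipschitzWith_schwartz {V F : Type*} [NormedAddCommGroup V] [NormedSpace ℝ V]
    [NormedAddCommGroup F] [NormedSpace ℝ F] (f : 𝓢(V, F)) : ∃ M : ℝ≥0, LipschitzWith M f :=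
  ⟨⟨SchwartzMap.seminorm ℝ 0 0 (SchwartzMap.fderivCLM ℝ V F f), apply_nonneg _ _⟩,
    lipschitzWith_of_nnnorm_fderiv_le f.differentiable fun x =>
      SchwartzMap.norm_le_seminorm ℝ (SchwartzMap.fderivCLM ℝ V F f) x⟩

lemma exists_lipschitzWith_green {t : ℝ} (ht : 0 < t) :
    ∃ M : ℝ≥0, LipschitzWith M (green d t) :=
  coe_greenReal (d := d) ht ▸ exists_lipschitzWith_schwartz _

lemma exists_lipschitzWith_fderiv_green {t : ℝ} (ht : 0 < t) :
    ∃ M : ℝ≥0, LipschitzWith M (fderiv ℝ (green d t)) :=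
  coe_fderivCLM_greenReal (d := d) ht ▸ exists_lipschitzWith_schwartz _

lemma green_pow_four_mul (t : ℝ) {l : ℝ} (hl : 0 < l) (x : E d) :
    green d (l ^ 4 * t) x = (l ^ d)⁻¹ * green d t (l⁻¹ • x) := by
  rw [green, green, ← Complex.re_ofReal_mul, Real.fourierInv_eq', Real.fourierInv_eq']
  have h := Measure.integral_comp_smul (volume : Measure (E d))
    (fun η => Complex.exp (((2 * Real.pi * inner ℝ η (l⁻¹ • x) : ℝ) : ℂ) * Complex.I) •
      ((Real.exp (-t * (2 * Real.pi * ‖η‖) ^ 4) : ℝ) : ℂ)) l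
  rw [finrank_euclideanSpace_fin, abs_of_pos (by positivity), Complex.real_smul] at h
  rw [← h]
  congr 2
  ext ξ
  have hphase : inner ℝ (l • ξ) (l⁻¹ • x) = inner ℝ ξ x := by
    rw [real_inner_smul_left, real_inner_smul_right, mul_inv_cancel_left₀ hl.ne']
  have hsymbol : -t * (2 * Real.pi * ‖l • ξ‖) ^ 4 = -(l ^ 4 * t) * (2 * Real.pi * ‖ξ‖) ^ 4 := by
    rw [norm_smul, Real.norm_of_nonneg hl.le]
    ring
  rw [hphase, hsymbol]

lemma green_pow_four {l : ℝ} (hl : 0 < l) (x : E d) :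
    green d (l ^ 4) x = (l ^ d)⁻¹ * green d 1 (l⁻¹ • x) := by
  simpa using green_pow_four_mul 1 hl x

lemma fderiv_green_pow_four {l : ℝ} (hl : 0 < l) (x : E d) :
    fderiv ℝ (green d (l ^ 4)) x = (l ^ (d + 1))⁻¹ • fderiv ℝ (green d 1) (l⁻¹ • x) := by
  have hscale : green d (l ^ 4) = (l ^ d)⁻¹ • (green d 1 ∘ fun x => l⁻¹ • x) :=
    funext (green_pow_four hl)
  rw [hscale, fderiv_const_smul ((differentiable_green one_pos _).comp x (by fun_prop)),
    Function.comp_def, fderiv_comp_smul, smul_smul, pow_succ, mul_inv]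

lemma symbol_add {s t : ℝ} (hs : 0 < s) (ht : 0 < t) (ξ : E d) :
    symbol d (add_pos hs ht) ξ = symbol d hs ξ * symbol d ht ξ := by
  rw [symbol_apply, symbol_apply, symbol_apply, ← Complex.ofReal_mul, ← Real.exp_add]
  congr 2
  ring

lemma greenSchwartz_add {s t : ℝ} (hs : 0 < s) (ht : 0 < t) :
    greenSchwartz d (add_pos hs ht) = SchwartzMap.convolution (ContinuousLinearMap.mul ℂ ℂ)
      (greenSchwartz d hs) (greenSchwartz d ht) := by
  have hfourier : symbol d (add_pos hs ht) = 𝓕 (SchwartzMap.convolution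
      (ContinuousLinearMap.mul ℂ ℂ) (greenSchwartz d hs) (greenSchwartz d ht)) := by
    rw [SchwartzMap.fourier_convolution]
    ext ξ
    simp only [greenSchwartz, SchwartzMap.pairing_apply_apply,
      FourierTransform.fourier_fourierInv_eq, ContinuousLinearMap.mul_apply', symbol_add hs ht]
  rw [greenSchwartz, hfourier, FourierTransform.fourierInv_fourier_eq]

lemma green_add {s t : ℝ} (hs : 0 < s) (ht : 0 < t) (x : E d) :
    green d (s + t) x = ∫ y, green d s y * green d t (x - y) := by
  have h := DFunLike.congr_fun (greenSchwartz_add (d := d) hs ht) x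
  simp only [SchwartzMap.convolution_apply, MeasureTheory.convolution,
    ContinuousLinearMap.mul_apply', greenSchwartz_eq_ofReal, ← Complex.ofReal_mul] at h
  exact Complex.ofReal_injective (h.trans integral_complex_ofReal)

lemma green_zero_pos {t : ℝ} (ht : 0 < t) : 0 < green d t 0 := by
  have h : green d t 0 = ∫ ξ : E d, Real.exp (-t * (2 * Real.pi * ‖ξ‖) ^ 4) := by
    apply Complex.ofReal_injective
    rw [← greenSchwartz_eq_ofReal ht, greenSchwartz_eq_fourierInv, Real.fourierInv_eq',
      ← integral_complex_ofReal]
    simp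
  rw [h]
  refine integral_exp_pos ?_
  simpa only [symbol_apply] using! ((symbol d ht).integrable (μ := volume)).re

end Kernel

section HolomorphicParameter

/-- Cauchy's estimate turns the bound for the integrand into one for its derivative. -/
lemma differentiable_integral_of_locally_dominated {α : Type*} [MeasurableSpace α] {μ : Measure α}
    {F : ℂ → α → ℂ} (hmeas : ∀ z, AEStronglyMeasurable (F z) μ)
    (hdiff : ∀ a, Differentiable ℂ (F · a))
    (hbound : ∀ r : ℝ, ∃ g : α → ℝ, Integrable g μ ∧ ∀ z a, ‖z‖ ≤ r → ‖F z a‖ ≤ g a) :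
    Differentiable ℂ fun z => ∫ a, F z a ∂μ := by
  intro z₀
  obtain ⟨g, hg, hFg⟩ := hbound (‖z₀‖ + 2)
  have hcauchy : ∀ a, ∀ z ∈ Metric.ball z₀ 1, ‖deriv (F · a) z‖ ≤ g a := by
    intro a z hz
    have hsphere : ∀ w ∈ Metric.sphere z 1, ‖F w a‖ ≤ g a := by
      refine fun w hw => hFg w a ?_
      have hwz : ‖w - z‖ = 1 := mem_sphere_iff_norm.1 hw
      have hzz₀ : ‖z - z₀‖ < 1 := mem_ball_iff_norm.1 hz
      calc ‖w‖ = ‖(w - z) + (z - z₀) + z₀‖ := by congr 1; ring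
        _ ≤ ‖w - z‖ + ‖z - z₀‖ + ‖z₀‖ := norm_add₃_le
        _ ≤ ‖z₀‖ + 2 := by linarith
    simpa using Complex.norm_deriv_le_of_forall_mem_sphere_norm_le one_pos
      (hdiff a).diffContOnCl hsphere
  have hderiv_meas : AEStronglyMeasurable (fun a => deriv (F · a) z₀) μ := by
    refine aestronglyMeasurable_of_tendsto_ae (nhdsWithin 0 {0}ᶜ)
      (f := fun h a => h⁻¹ • (F (z₀ + h) a - F z₀ a))
      (fun h => ((hmeas (z₀ + h)).sub (hmeas z₀)).const_smul h⁻¹) (.of_forall fun a => ?_)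
    exact (hdiff a z₀).hasDerivAt.tendsto_slope_zero
  exact (hasDerivAt_integral_of_dominated_loc_of_deriv_le (F' := fun z a => deriv (F · a) z)
    (Metric.ball_mem_nhds z₀ one_pos) (.of_forall hmeas)
    (hg.mono' (hmeas z₀) (.of_forall fun a => hFg z₀ a (by linarith)))
    hderiv_meas (.of_forall hcauchy) hg
    (.of_forall fun a z _ => (hdiff a z).hasDerivAt)).2.differentiableAt

lemma eq_of_differentiable_of_forall_ofReal {f : ℂ → ℂ} {c : ℂ} (hf : Differentiable ℂ f)
    (hreal : ∀ s : ℝ, f s = c) (z : ℂ) : f z = c := by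
  refine congrFun ((hf.differentiableOn.analyticOnNhd isOpen_univ).eq_of_frequently_eq (z₀ := 0)
    (g := fun _ => c) analyticOnNhd_const ?_) z
  have hofReal : Filter.Tendsto ((↑) : ℝ → ℂ) (nhdsWithin 0 {0}ᶜ) (nhdsWithin 0 {0}ᶜ) := by
    refine tendsto_nhdsWithin_iff.2 ⟨?_, ?_⟩
    · simpa using (Complex.continuous_ofReal.tendsto 0).mono_left nhdsWithin_le_nhds
    · filter_upwards [self_mem_nhdsWithin] with s hs
      simpa using hs
  exact hofReal.frequently (Filter.Eventually.of_forall hreal).frequently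

end HolomorphicParameter

section ContourShift

variable {d : ℕ}

/-- The integrand of the inversion formula for `G(1, x)` with the frequency `ξ` shifted to
`ξ + z e`, where `z` is complex and `‖ξ + z e‖²` is continued holomorphically in `z`. -/
def shiftedIntegrand (x e ξ : E d) (z : ℂ) : ℂ :=
  Complex.exp (2 * Real.pi * (inner ℝ ξ x + z * inner ℝ e x) * Complex.I -
    (2 * Real.pi) ^ 4 * ((‖ξ‖ : ℂ) ^ 2 + (2 * z * inner ℝ ξ e + z ^ 2 * ‖e‖ ^ 2)) ^ 2)

lemma shiftedIntegrand_ofReal (x e ξ : E d) (s : ℝ) :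
    shiftedIntegrand x e ξ s = shiftedIntegrand x e (ξ + s • e) 0 := by
  have hnorm : (‖ξ + s • e‖ : ℂ) ^ 2 =
      (‖ξ‖ : ℂ) ^ 2 + (2 * s * inner ℝ ξ e + s ^ 2 * ‖e‖ ^ 2) := by
    have h : ‖ξ + s • e‖ ^ 2 = ‖ξ‖ ^ 2 + (2 * s * inner ℝ ξ e + s ^ 2 * ‖e‖ ^ 2) := by
      rw [norm_add_sq_real, norm_smul, real_inner_smul_right, mul_pow, Real.norm_eq_abs, sq_abs]
      ring
    exact_mod_cast congrArg (fun r : ℝ => (r : ℂ)) h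
  rw [shiftedIntegrand, shiftedIntegrand, hnorm, inner_add_left, real_inner_smul_left]
  push_cast
  ring_nf

lemma le_re_sq_add_sq {a n : ℝ} {w : ℂ} (hw : ‖w‖ ≤ 2 * n * a + n ^ 2) :
    a ^ 4 / 2 - 1610 * n ^ 4 ≤ (((a : ℂ) ^ 2 + w) ^ 2).re := by
  have expand : (((a : ℂ) ^ 2 + w) ^ 2).re = a ^ 4 + 2 * a ^ 2 * w.re + (w ^ 2).re := by
    have h : ((a : ℂ) ^ 2 + w) ^ 2 = ((a ^ 4 : ℝ) : ℂ) + ((2 * a ^ 2 : ℝ) : ℂ) * w + w ^ 2 := by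
      push_cast
      ring
    rw [h, Complex.add_re, Complex.add_re, Complex.ofReal_re, Complex.re_ofReal_mul]
  have hre : -‖w‖ ≤ w.re := neg_le_of_abs_le (Complex.abs_re_le_norm w)
  have hre_sq : -‖w‖ ^ 2 ≤ (w ^ 2).re := by
    rw [← norm_pow]
    exact neg_le_of_abs_le (Complex.abs_re_le_norm (w ^ 2))
  have hw_sq : ‖w‖ ^ 2 ≤ 8 * (n * a) ^ 2 + 2 * n ^ 4 :=
    calc ‖w‖ ^ 2 ≤ (2 * n * a + n ^ 2) ^ 2 := by gcongr
      _ ≤ 8 * (n * a) ^ 2 + 2 * n ^ 4 := by nlinarith [sq_nonneg (2 * n * a - n ^ 2)]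
  have hcross : 2 * a ^ 2 * ‖w‖ ≤ a ^ 4 / 4 + 4 * ‖w‖ ^ 2 := by
    nlinarith [sq_nonneg (a ^ 2 / 2 - 2 * ‖w‖)]
  have habsorb : 40 * (n * a) ^ 2 ≤ a ^ 4 / 4 + 1600 * n ^ 4 := by
    nlinarith [sq_nonneg (a ^ 2 / 2 - 40 * n ^ 2)]
  have hre_mul : -(2 * a ^ 2 * ‖w‖) ≤ 2 * a ^ 2 * w.re := by
    rw [← mul_neg]
    gcongr
  linarith

lemma norm_shiftedIntegrand_le (x e ξ : E d) (z : ℂ) :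
    ‖shiftedIntegrand x e ξ z‖ ≤
      Real.exp (-(2 * Real.pi * (z.im * inner ℝ e x)) +
        (2 * Real.pi) ^ 4 * (1610 * (‖z‖ * ‖e‖) ^ 4)) *
      Real.exp (-((2 * Real.pi) ^ 4 / 2) * ‖ξ‖ ^ 4) := by
  set w : ℂ := 2 * z * inner ℝ ξ e + z ^ 2 * ‖e‖ ^ 2 with hw_def
  have hw : ‖w‖ ≤ 2 * (‖z‖ * ‖e‖) * ‖ξ‖ + (‖z‖ * ‖e‖) ^ 2 := by
    refine (norm_add_le _ _).trans (add_le_add ?_ (by simp [mul_pow]))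
    simp only [norm_mul, Complex.norm_real, Real.norm_eq_abs, Complex.norm_ofNat]
    calc 2 * ‖z‖ * |inner ℝ ξ e| ≤ 2 * ‖z‖ * (‖ξ‖ * ‖e‖) := by
          gcongr
          exact abs_real_inner_le_norm ξ e
      _ = 2 * (‖z‖ * ‖e‖) * ‖ξ‖ := by ring
  have hphase : (2 * Real.pi * (inner ℝ ξ x + z * inner ℝ e x) * Complex.I : ℂ).re =
      -(2 * Real.pi * (z.im * inner ℝ e x)) := by
    simp [Complex.mul_re, Complex.mul_im]
  have hquartic : ((2 * Real.pi : ℂ) ^ 4 * ((‖ξ‖ : ℂ) ^ 2 + w) ^ 2).re =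
      (2 * Real.pi) ^ 4 * (((‖ξ‖ : ℂ) ^ 2 + w) ^ 2).re := by
    rw [← Complex.re_ofReal_mul]
    push_cast
    rfl
  rw [shiftedIntegrand, ← hw_def, Complex.norm_exp, ← Real.exp_add, Complex.sub_re, hphase,
    hquartic]
  refine Real.exp_le_exp.2 ?_
  have := mul_le_mul_of_nonneg_left (le_re_sq_add_sq hw) (by positivity : 0 ≤ (2 * Real.pi) ^ 4)
  linarith

lemma continuous_shiftedIntegrand (x e : E d) (z : ℂ) :
    Continuous fun ξ => shiftedIntegrand x e ξ z := by
  unfold shiftedIntegrand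
  fun_prop

lemma differentiable_shiftedIntegrand (x e ξ : E d) :
    Differentiable ℂ (shiftedIntegrand x e ξ) := by
  unfold shiftedIntegrand
  fun_prop

lemma norm_shiftedIntegrand_le_of_norm_le (x e ξ : E d) {z : ℂ} {r : ℝ} (hz : ‖z‖ ≤ r) :
    ‖shiftedIntegrand x e ξ z‖ ≤
      Real.exp (2 * Real.pi * (r * (‖e‖ * ‖x‖)) + (2 * Real.pi) ^ 4 * (1610 * (r * ‖e‖) ^ 4)) *
        Real.exp (-((2 * Real.pi) ^ 4 / 2) * ‖ξ‖ ^ 4) := by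
  refine (norm_shiftedIntegrand_le x e ξ z).trans ?_
  gcongr
  rw [← mul_neg]
  gcongr
  calc -(z.im * inner ℝ e x) ≤ |z.im| * |inner ℝ e x| := by
        rw [← abs_mul]
        exact neg_le_abs _
    _ ≤ r * (‖e‖ * ‖x‖) := by
        gcongr
        · exact (norm_nonneg z).trans hz
        · exact (Complex.abs_im_le_norm z).trans hz
        · exact abs_real_inner_le_norm e x

lemma differentiable_integral_shiftedIntegrand (x e : E d) :
    Differentiable ℂ fun z => ∫ ξ, shiftedIntegrand x e ξ z :=
  differentiable_integral_of_locally_dominated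
    (fun z => (continuous_shiftedIntegrand x e z).aestronglyMeasurable)
    (differentiable_shiftedIntegrand x e)
    fun _ => ⟨_, (integrable_exp_neg_mul_norm_pow_four volume (by positivity)).const_mul _,
      fun _ ξ hz => norm_shiftedIntegrand_le_of_norm_le x e ξ hz⟩

lemma integral_shiftedIntegrand (x e : E d) (z : ℂ) :
    ∫ ξ, shiftedIntegrand x e ξ z = ∫ ξ, shiftedIntegrand x e ξ 0 := by
  refine eq_of_differentiable_of_forall_ofReal (differentiable_integral_shiftedIntegrand x e)
    (fun s => ?_) z
  simp_rw [shiftedIntegrand_ofReal x e]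
  exact integral_add_right_eq_self (fun ξ => shiftedIntegrand x e ξ 0) (s • e)

lemma green_one_eq_integral_shiftedIntegrand (x e : E d) (z : ℂ) :
    (green d 1 x : ℂ) = ∫ ξ, shiftedIntegrand x e ξ z := by
  rw [integral_shiftedIntegrand, ← greenSchwartz_eq_ofReal one_pos, greenSchwartz_eq_fourierInv,
    Real.fourierInv_eq']
  congr 1
  ext ξ
  rw [shiftedIntegrand, smul_eq_mul, Complex.ofReal_exp, ← Complex.exp_add]
  congr 1
  push_cast
  ring

lemma abs_green_one_le_exp (x e : E d) :
    |green d 1 x| ≤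
      Real.exp (-(2 * Real.pi * inner ℝ e x) + (2 * Real.pi) ^ 4 * (1610 * ‖e‖ ^ 4)) *
        ∫ ξ : E d, Real.exp (-((2 * Real.pi) ^ 4 / 2) * ‖ξ‖ ^ 4) := by
  rw [← Real.norm_eq_abs, ← Complex.norm_real,
    green_one_eq_integral_shiftedIntegrand x e Complex.I, ← integral_const_mul]
  refine norm_integral_le_of_norm_le
    ((integrable_exp_neg_mul_norm_pow_four volume (by positivity)).const_mul _)
    (.of_forall fun ξ => ?_)
  simpa using norm_shiftedIntegrand_le x e ξ Complex.I

lemma exists_abs_green_one_le (d : ℕ) :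
    ∃ C c : ℝ, 0 < C ∧ 0 < c ∧ ∀ x : E d,
      |green d 1 x| ≤ C * Real.exp (-c * ‖x‖ ^ (4 / 3 : ℝ)) := by
  set A := ∫ ξ : E d, Real.exp (-((2 * Real.pi) ^ 4 / 2) * ‖ξ‖ ^ 4)
  refine ⟨A, 1 / 1000,
    integral_exp_pos (integrable_exp_neg_mul_norm_pow_four volume (by positivity)),
    by norm_num, fun x => ?_⟩
  rcases eq_or_ne x 0 with rfl | hx
  · simpa [A, Real.zero_rpow] using abs_green_one_le_exp (0 : E d) 0
  have hx_pos : 0 < ‖x‖ := norm_pos_iff.2 hx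
  -- The shift `e = (‖x‖^{1/3} / 1000) x / ‖x‖` has `⟪e, x⟫` and `‖e‖⁴` both of order `‖x‖^{4/3}`.
  set e : E d := (1 / 1000 * ‖x‖ ^ (1 / 3 : ℝ) / ‖x‖) • x with he
  have hinner : inner ℝ e x = 1 / 1000 * ‖x‖ ^ (4 / 3 : ℝ) := by
    rw [he, real_inner_smul_left, real_inner_self_eq_norm_sq,
      show (4 / 3 : ℝ) = 1 / 3 + 1 by norm_num, Real.rpow_add_one hx_pos.ne']
    field_simp
  have hnorm : ‖e‖ ^ 4 = (1 / 1000) ^ 4 * ‖x‖ ^ (4 / 3 : ℝ) := by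
    rw [he, norm_smul, Real.norm_of_nonneg (by positivity), div_mul_cancel₀ _ hx_pos.ne',
      mul_pow, ← Real.rpow_natCast (‖x‖ ^ (1 / 3 : ℝ)) 4, ← Real.rpow_mul hx_pos.le]
    norm_num
  refine (abs_green_one_le_exp x e).trans ?_
  rw [hinner, hnorm, mul_comm A]
  gcongr
  have hpi : (2 * Real.pi) ^ 4 ≤ 8 ^ 4 := by
    gcongr
    linarith [Real.pi_le_four]
  have hpow : 0 ≤ ‖x‖ ^ (4 / 3 : ℝ) := by positivity
  nlinarith [mul_le_mul_of_nonneg_right hpi hpow,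
    mul_le_mul_of_nonneg_right Real.pi_gt_three.le hpow]

end ContourShift

section KernelGradient

variable {d : ℕ}

/-- A Landau-type inequality. -/
lemma norm_deriv_le_of_norm_le_of_norm_sub_le {F : Type*} [NormedAddCommGroup F] [NormedSpace ℝ F]
    {f f' : ℝ → F} {a s η κ : ℝ} (hs : 0 < s) (hf : ∀ u ∈ Icc a (a + s), HasDerivAt f (f' u) u)
    (hf' : ∀ u ∈ Icc a (a + s), ‖f' u - f' a‖ ≤ κ) (ha : ‖f a‖ ≤ η) (has : ‖f (a + s)‖ ≤ η) :
    ‖f' a‖ ≤ 2 * η / s + κ := by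
  have htaylor : ‖f (a + s) - f a - s • f' a‖ ≤ κ * s := by
    have h := norm_image_sub_le_of_norm_deriv_le_segment' (f := fun u => f u - u • f' a)
      (f' := fun u => f' u - f' a) (C := κ)
      (fun u hu => by
        simpa using ((hf u hu).fun_sub ((hasDerivAt_id u).smul_const (f' a))).hasDerivWithinAt)
      (fun u hu => hf' u (Ico_subset_Icc_self hu)) (a + s)
      (right_mem_Icc.2 (by linarith))
    rw [add_sub_cancel_left] at h
    convert h using 2
    rw [add_smul]
    abel
  have hscaled : s * ‖f' a‖ ≤ 2 * η + κ * s :=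
    calc s * ‖f' a‖ = ‖f (a + s) - f a - (f (a + s) - f a - s • f' a)‖ := by
          rw [sub_sub_cancel, norm_smul, Real.norm_of_nonneg hs.le]
      _ ≤ ‖f (a + s)‖ + ‖f a‖ + ‖f (a + s) - f a - s • f' a‖ :=
          (norm_sub_le _ _).trans (by gcongr; exact norm_sub_le _ _)
      _ ≤ 2 * η + κ * s := by linarith
  rw [div_add' _ _ _ hs.ne', le_div_iff₀ hs]
  linarith

lemma hasDerivAt_comp_add_smul {V F : Type*} [NormedAddCommGroup V] [NormedSpace ℝ V]
    [NormedAddCommGroup F] [NormedSpace ℝ F] {f : V → F} (hf : Differentiable ℝ f) (x v : V)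
    (u : ℝ) : HasDerivAt (fun u : ℝ => f (x + u • v)) (fderiv ℝ f (x + u • v) v) u := by
  have hline : HasDerivAt (fun u : ℝ => x + u • v) v u := by
    simpa using ((hasDerivAt_id u).smul_const v).const_add x
  exact (hf _).hasFDerivAt.comp_hasDerivAt u hline

lemma norm_fderiv_apply_le_of_lipschitzWith_fderiv {V F : Type*} [NormedAddCommGroup V]
    [NormedSpace ℝ V] [NormedAddCommGroup F] [NormedSpace ℝ F] {f : V → F} {M : ℝ≥0}
    (hf : Differentiable ℝ f) (hf' : LipschitzWith M (fderiv ℝ f)) {x v : V} (hv : ‖v‖ = 1)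
    {s η : ℝ} (hs : 0 < s) (hx : ‖f x‖ ≤ η) (hxv : ‖f (x + s • v)‖ ≤ η) :
    ‖fderiv ℝ f x v‖ ≤ 2 * η / s + M * s := by
  have h := norm_deriv_le_of_norm_le_of_norm_sub_le (a := 0) (κ := M * s) (η := η)
    (f' := fun u => fderiv ℝ f (x + u • v) v) hs
    (fun u _ => hasDerivAt_comp_add_smul hf x v u) (fun u hu => ?_) (by simpa using hx)
    (by simpa using hxv)
  · simpa using h
  rw [← sub_apply]
  refine (ContinuousLinearMap.le_opNorm _ v).trans ?_
  rw [hv, mul_one]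
  refine (hf'.norm_sub_le _ _).trans ?_
  gcongr
  rw [add_sub_add_left_eq_sub, ← sub_smul, norm_smul, hv, sub_zero, mul_one,
    Real.norm_of_nonneg hu.1]
  simpa using hu.2

lemma norm_fderiv_le_of_norm_le_outside_ball {V : Type*} [NormedAddCommGroup V]
    [InnerProductSpace ℝ V] {f : V → ℝ} {M : ℝ≥0} (hf : Differentiable ℝ f)
    (hf' : LipschitzWith M (fderiv ℝ f)) {x : V} {s η : ℝ} (hs : 0 < s)
    (hη : ∀ y, ‖x‖ ≤ ‖y‖ → ‖f y‖ ≤ η) : ‖fderiv ℝ f x‖ ≤ 2 * η / s + M * s := by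
  have hη_nonneg : 0 ≤ η := (norm_nonneg _).trans (hη x le_rfl)
  have houtward : ∀ v : V, ‖v‖ = 1 → 0 ≤ inner ℝ x v →
      ‖fderiv ℝ f x v‖ ≤ 2 * η / s + M * s := by
    refine fun v hv hxv => norm_fderiv_apply_le_of_lipschitzWith_fderiv hf hf' hv hs (hη x le_rfl)
      (hη _ (le_of_sq_le_sq ?_ (norm_nonneg _)))
    rw [norm_add_sq_real, real_inner_smul_right]
    nlinarith [mul_nonneg hs.le hxv, sq_nonneg ‖s • v‖]
  refine ContinuousLinearMap.opNorm_le_of_unit_norm (by positivity) fun v hv => ?_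
  rcases le_total 0 (inner ℝ x v) with h | h
  · exact houtward v hv h
  · simpa using houtward (-v) (by rwa [norm_neg]) (by rwa [inner_neg_right, neg_nonneg])

lemma exists_norm_fderiv_green_one_le (d : ℕ) :
    ∃ C c : ℝ, 0 < C ∧ 0 < c ∧ ∀ x : E d,
      ‖fderiv ℝ (green d 1) x‖ ≤ C * Real.exp (-c * ‖x‖ ^ (4 / 3 : ℝ)) := by
  obtain ⟨C, c, hC, hc, hgreen⟩ := exists_abs_green_one_le d
  obtain ⟨M, hM⟩ := exists_lipschitzWith_fderiv_green (d := d) one_pos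
  refine ⟨2 * C + M, c / 2, by positivity, by positivity, fun x => ?_⟩
  -- The step is the square root of the bound for the kernel.
  set s := Real.exp (-(c / 2) * ‖x‖ ^ (4 / 3 : ℝ))
  have hs : 0 < s := Real.exp_pos _
  have hs_sq : Real.exp (-c * ‖x‖ ^ (4 / 3 : ℝ)) = s * s := by
    rw [← Real.exp_add]
    congr 1
    ring
  calc ‖fderiv ℝ (green d 1) x‖ ≤ 2 * (C * (s * s)) / s + M * s := by
        refine norm_fderiv_le_of_norm_le_outside_ball (differentiable_green one_pos) hM hs
          fun y hy => (hgreen y).trans ?_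
        rw [← hs_sq]
        have := Real.rpow_le_rpow (norm_nonneg x) hy (by norm_num : (0 : ℝ) ≤ 4 / 3)
        gcongr C * Real.exp ?_
        nlinarith
    _ = (2 * C + M) * s := by field_simp

lemma exists_abs_green_one_le_and_norm_fderiv_green_one_le (d : ℕ) :
    ∃ C c : ℝ, 0 < C ∧ 0 < c ∧ ∀ x : E d,
      |green d 1 x| ≤ C * Real.exp (-c * ‖x‖ ^ (4 / 3 : ℝ)) ∧
      ‖fderiv ℝ (green d 1) x‖ ≤ C * Real.exp (-c * ‖x‖ ^ (4 / 3 : ℝ)) := by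
  obtain ⟨C, c, hC, hc, h⟩ := exists_abs_green_one_le d
  obtain ⟨C', c', -, hc', h'⟩ := exists_norm_fderiv_green_one_le d
  refine ⟨max C C', min c c', by positivity, by positivity, fun x =>
    ⟨(h x).trans ?_, (h' x).trans ?_⟩⟩ <;> gcongr
  exacts [le_max_left _ _, min_le_left _ _, le_max_right _ _, min_le_right _ _]

end KernelGradient

section GradientSemigroup

open scoped SchwartzMap LineDeriv

lemma hasFDerivAt_integral_smul_schwartz {V F : Type*} [NormedAddCommGroup V] [NormedSpace ℝ V]
    [MeasurableSpace V] [BorelSpace V] [SecondCountableTopology V] [NormedAddCommGroup F]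
    [NormedSpace ℝ F] {μ : Measure V} {g : V → ℝ} (hg : Integrable g μ) (f : 𝓢(V, F)) (x : V) :
    HasFDerivAt (fun x => ∫ y, g y • f (x - y) ∂μ) (∫ y, g y • fderiv ℝ f (x - y) ∂μ) x := by
  set f' : 𝓢(V, V →L[ℝ] F) := SchwartzMap.fderivCLM ℝ V F f
  have hmeas : ∀ z, AEStronglyMeasurable (fun y => g y • f (z - y)) μ := fun z =>
    hg.aestronglyMeasurable.smul
      (f.continuous.comp (continuous_const.sub continuous_id)).aestronglyMeasurable
  refine hasFDerivAt_integral_of_dominated_of_fderiv_le (𝕜 := ℝ)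
    (F' := fun z y => g y • fderiv ℝ f (z - y))
    (bound := fun y => ‖g y‖ * SchwartzMap.seminorm ℝ 0 0 f') Filter.univ_mem
    (.of_forall hmeas) ?_ ?_ (.of_forall fun y z _ => ?_) (hg.norm.mul_const _)
    (.of_forall fun y z _ => ?_)
  · refine (hg.norm.mul_const (SchwartzMap.seminorm ℝ 0 0 f)).mono' (hmeas x)
      (.of_forall fun y => ?_)
    rw [norm_smul]
    gcongr
    exact SchwartzMap.norm_le_seminorm ℝ f _
  · exact hg.aestronglyMeasurable.smul
      (f'.continuous.comp (continuous_const.sub continuous_id)).aestronglyMeasurable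
  · rw [norm_smul]
    gcongr
    exact SchwartzMap.norm_le_seminorm ℝ f' _
  · exact ((hasFDerivAt_comp_sub (𝕜 := ℝ) y).2 f.differentiableAt.hasFDerivAt).const_smul (g y)

variable {d : ℕ}

lemma fderiv_green_add {s t : ℝ} (hs : 0 < s) (ht : 0 < t) (x : E d) :
    fderiv ℝ (green d (s + t)) x = ∫ y, green d s y • fderiv ℝ (green d t) (x - y) := by
  rw [funext (green_add hs ht)]
  simpa [coe_greenReal] using
    (hasFDerivAt_integral_smul_schwartz (integrable_green hs) (greenReal d ht) x).fderiv

lemma lineDerivOp_greenSchwartz {t : ℝ} (ht : 0 < t) (m x : E d) :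
    ∂_{m} (greenSchwartz d ht) x = (fderiv ℝ (green d t) x m : ℂ) := by
  have hcoe : (greenSchwartz d ht : E d → ℂ) = Complex.ofRealCLM ∘ green d t :=
    funext (greenSchwartz_eq_ofReal ht)
  rw [SchwartzMap.lineDerivOp_apply_eq_fderiv, hcoe,
    (Complex.ofRealCLM.hasFDerivAt.comp x (differentiable_green ht x).hasFDerivAt).fderiv]
  rfl

lemma integral_fderiv_green {t : ℝ} (ht : 0 < t) : ∫ x, fderiv ℝ (green d t) x = 0 := by
  ext m
  rw [ContinuousLinearMap.integral_apply (integrable_fderiv_green ht), zero_apply]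
  have h := integral_mul_fderiv_eq_neg_fderiv_mul_of_integrable (μ := (volume : Measure (E d)))
    (f := fun _ => (1 : ℝ)) (g := green d t) (v := m)
    (by simp) (by simpa using (integrable_fderiv_green ht).apply_continuousLinearMap m)
    (by simpa using integrable_green ht) (by fun_prop) (fun x _ => differentiable_green ht x)
  simpa using h

end GradientSemigroup

section RadialEquation

open scoped SchwartzMap LineDeriv Laplacian

section RotationInvariance

variable {V : Type*} [NormedAddCommGroup V] [InnerProductSpace ℝ V]

lemma hasDerivAt_schwartz_line {F : Type*} [NormedAddCommGroup F] [NormedSpace ℝ F] (f : 𝓢(V, F))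
    (x v : V) (u : ℝ) : HasDerivAt (fun u : ℝ => f (x + u • v)) (∂_{v} f (x + u • v)) u := by
  rw [SchwartzMap.lineDerivOp_apply_eq_fderiv]
  exact hasDerivAt_comp_add_smul f.differentiable x v u

lemma lineDerivOp_smulLeftCLM_inner (f : 𝓢(V, ℂ)) (e v x : V) :
    ∂_{v} (SchwartzMap.smulLeftCLM ℂ (inner ℝ · e) f) x =
      (inner ℝ v e : ℝ) * f x + (inner ℝ x e : ℝ) * ∂_{v} f x := by
  have hprod := hasDerivAt_schwartz_line (SchwartzMap.smulLeftCLM ℂ (inner ℝ · e) f) x v 0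
  have hinner :
      HasDerivAt (fun u : ℝ => ((inner ℝ (x + u • v) e : ℝ) : ℂ)) (inner ℝ v e : ℝ) 0 := by
    have h := hasDerivAt_comp_add_smul (f := fun y : V => inner ℝ y e)
      (differentiable_id.inner ℝ (differentiable_const e)) x v 0
    refine HasDerivAt.ofReal_comp (h.congr_deriv ?_)
    simp [fderiv_inner_apply]
  have hleibniz := hinner.mul (hasDerivAt_schwartz_line f x v 0)
  simp only [SchwartzMap.smulLeftCLM_apply_apply (by fun_prop : (inner ℝ · e).HasTemperateGrowth),
    Complex.real_smul, zero_smul, add_zero] at hprod hleibniz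
  exact hprod.unique hleibniz

/-- Invariance of a Schwartz function under rotations, in infinitesimal form: the angular
derivatives `⟪x, e⟫ ∂_v - ⟪x, v⟫ ∂_e` annihilate it. -/
def IsRotationInvariant (f : 𝓢(V, ℂ)) : Prop :=
  ∀ e v x : V, (inner ℝ x e : ℝ) * ∂_{v} f x = (inner ℝ x v : ℝ) * ∂_{e} f x

namespace IsRotationInvariant

lemma fourierInv [FiniteDimensional ℝ V] [MeasurableSpace V] [BorelSpace V] {f : 𝓢(V, ℂ)}
    (hf : IsRotationInvariant f) : IsRotationInvariant (𝓕⁻ f) := by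
  intro e v x
  have hsymbol : (2 * Real.pi * Complex.I) • SchwartzMap.smulLeftCLM ℂ (inner ℝ · v) (∂_{e} f) =
      (2 * Real.pi * Complex.I) • SchwartzMap.smulLeftCLM ℂ (inner ℝ · e) (∂_{v} f) := by
    congr 1
    ext ξ
    have hinner : ∀ w : V, (inner ℝ · w).HasTemperateGrowth := fun w => by fun_prop
    simpa [SchwartzMap.smulLeftCLM_apply_apply (hinner _)] using (hf e v ξ).symm
  have h := congrArg (fun g : 𝓢(V, ℂ) => (𝓕⁻ g) x) hsymbol
  simp only [← SchwartzMap.lineDerivOp_fourierInv_eq, SchwartzMap.fourierInv_lineDerivOp_eq,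
    LineDeriv.lineDerivOp_smul, smul_apply, lineDerivOp_smulLeftCLM_inner, smul_eq_mul] at h
  have h := mul_left_cancel₀ (by simp [Real.pi_ne_zero] : -(2 * Real.pi * Complex.I) ≠ 0) h
  rw [real_inner_comm] at h
  exact add_left_cancel h

variable {f : 𝓢(V, ℂ)} {e v : V}

lemma lineDerivOp_lineDerivOp_of_inner_eq_zero (hf : IsRotationInvariant f) (he : ‖e‖ = 1)
    (hv : ‖v‖ = 1) (hev : inner ℝ e v = 0) (r : ℝ) :
    r * ∂_{v} (∂_{v} f) (r • e) = ∂_{e} f (r • e) := by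
  have hline : ∀ u : ℝ, (r : ℂ) * ∂_{v} f (r • e + u • v) = (u : ℂ) * ∂_{e} f (r • e + u • v) := by
    intro u
    simpa [inner_add_left, real_inner_smul_left, hev, real_inner_comm e v, he, hv] using
      hf e v (r • e + u • v)
  have hleft := (hasDerivAt_schwartz_line (∂_{v} f) (r • e) v 0).const_mul (r : ℂ)
  have hright := (Complex.ofRealCLM.hasDerivAt (x := (0 : ℝ))).mul
    (hasDerivAt_schwartz_line (∂_{e} f) (r • e) v 0)
  simp only [hline] at hleft
  simpa using hleft.unique hright

lemma laplacian_ray [FiniteDimensional ℝ V] (hf : IsRotationInvariant f) (he : ‖e‖ = 1) (r : ℝ) :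
    r * Δ f (r • e) =
      r * ∂_{e} (∂_{e} f) (r • e) + (Module.finrank ℝ V - 1) * ∂_{e} f (r • e) := by
  classical
  have hon : Orthonormal ℝ ((↑) : ({e} : Set V) → V) :=
    ⟨fun i => by rw [i.2, he], fun i j hij => (hij (Subsingleton.elim i j)).elim⟩
  obtain ⟨u, b, hu, hb⟩ := hon.exists_orthonormalBasis_extension
  let i₀ : u := ⟨e, hu rfl⟩
  have hb₀ : b i₀ = e := by rw [hb]
  rw [SchwartzMap.laplacian_eq_sum b, sum_apply,
    ← Finset.add_sum_erase _ _ (Finset.mem_univ i₀), hb₀, mul_add, Finset.mul_sum,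
    Finset.sum_congr rfl (g := fun _ => ∂_{e} f (r • e)) fun i hi => ?_]
  · have hcard : 1 ≤ u.card := Finset.card_pos.2 ⟨i₀, i₀.2⟩
    simp [Module.finrank_eq_card_basis b.toBasis, Nat.cast_sub hcard]
  · refine hf.lineDerivOp_lineDerivOp_of_inner_eq_zero he (b.norm_eq_one i) ?_ r
    rw [← hb₀]
    exact b.inner_eq_zero (Finset.ne_of_mem_erase hi).symm

end IsRotationInvariant

end RotationInvariance

variable {d : ℕ}

lemma lineDerivOp_symbol_one (e ξ : E d) :
    ∂_{e} (symbol d one_pos) ξ =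
      -(4 * (2 * Real.pi) ^ 4 * ((‖ξ‖ : ℂ) ^ 2 * (inner ℝ ξ e : ℝ))) * symbol d one_pos ξ := by
  have hcoe : (symbol d one_pos : E d → ℂ) =
      Complex.ofRealCLM ∘ fun ξ => Real.exp (-(2 * Real.pi) ^ 4 * (‖ξ‖ ^ 2) ^ 2) := by
    ext ξ
    rw [symbol_apply, Function.comp_apply, Complex.ofRealCLM_apply]
    congr 2
    ring
  have hderiv := (((hasStrictFDerivAt_norm_sq ξ).hasFDerivAt.pow 2).const_mul
    (-(2 * Real.pi) ^ 4)).exp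
  rw [SchwartzMap.lineDerivOp_apply_eq_fderiv, hcoe,
    (Complex.ofRealCLM.hasFDerivAt.comp ξ hderiv).fderiv]
  simp
  ring

lemma isRotationInvariant_greenSchwartz : IsRotationInvariant (greenSchwartz d one_pos) := by
  refine IsRotationInvariant.fourierInv fun e v ξ => ?_
  rw [lineDerivOp_symbol_one, lineDerivOp_symbol_one]
  ring

lemma laplacian_greenSchwartz :
    Δ (greenSchwartz d one_pos) = 𝓕⁻ (-(2 * Real.pi) ^ 2 •
      SchwartzMap.smulLeftCLM ℂ (fun ξ : E d => ‖ξ‖ ^ 2) (symbol d one_pos)) := by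
  rw [SchwartzMap.laplacian_eq_fourierMultiplierCLM, SchwartzMap.fourierMultiplierCLM_apply,
    FourierTransform.fourierInv_smul, greenSchwartz, FourierTransform.fourier_fourierInv_eq]

/-- The Fourier side of this identity is `∂_e e^{-|ξ|⁴} = -4 |ξ|² ⟪ξ, e⟫ e^{-|ξ|⁴}`. -/
lemma lineDerivOp_laplacian_greenSchwartz (e x : E d) :
    ∂_{e} (Δ (greenSchwartz d one_pos)) x = (inner ℝ x e / 4 : ℝ) * greenSchwartz d one_pos x := by
  have hinner : (fun ξ : E d => inner ℝ ξ e).HasTemperateGrowth := by fun_prop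
  have hnorm_sq : (fun ξ : E d => ‖ξ‖ ^ 2).HasTemperateGrowth := by fun_prop
  have hsymbol : ∂_{e} (symbol d one_pos) =
      (-(8 * Real.pi * Complex.I)) • ((2 * Real.pi * Complex.I) •
        SchwartzMap.smulLeftCLM ℂ (inner ℝ · e) (-(2 * Real.pi) ^ 2 •
          SchwartzMap.smulLeftCLM ℂ (fun ξ : E d => ‖ξ‖ ^ 2) (symbol d one_pos))) := by
    ext ξ
    simp only [lineDerivOp_symbol_one, smul_apply, SchwartzMap.smulLeftCLM_apply_apply hinner,
      SchwartzMap.smulLeftCLM_apply_apply hnorm_sq, smul_eq_mul, Complex.real_smul]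
    push_cast
    linear_combination (-64 * Real.pi ^ 4 * (inner ℝ ξ e : ℝ) * (‖ξ‖ : ℂ) ^ 2 *
      symbol d one_pos ξ) * Complex.I_sq
  have h := congrArg (fun f : 𝓢(E d, ℂ) => (𝓕⁻ f) x) hsymbol
  simp only [SchwartzMap.fourierInv_lineDerivOp_eq, FourierTransform.fourierInv_smul (R := ℂ)] at h
  rw [← FourierTransform.fourierInv_smul, ← SchwartzMap.lineDerivOp_fourierInv_eq,
    ← laplacian_greenSchwartz, ← greenSchwartz] at h
  simp only [smul_apply, SchwartzMap.smulLeftCLM_apply_apply hinner, smul_eq_mul,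
    Complex.real_smul] at h
  apply mul_left_cancel₀ (by simp [Real.pi_ne_zero] : (Real.pi : ℂ) * Complex.I ≠ 0)
  push_cast
  linear_combination (1 / 8 : ℂ) * h

end RadialEquation

section RadialSystem

/-- The third-order equation satisfied by a radial solution of `4 ∇Δu = x u` in dimension `n + 1`,
written as a first-order system for its profile `A`, the radial derivative `B = A'` and the
Laplacian `D = B' + n B / r`, on the half-line `[r₀, ∞)`. -/
structure RadialSystem (n r₀ : ℝ) (A B D : ℝ → ℝ) : Prop where
  hasDerivAt_profile : ∀ r, r₀ ≤ r → HasDerivAt A (B r) r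
  hasDerivAt_slope : ∀ r, r₀ ≤ r → HasDerivAt B (D r - n / r * B r) r
  hasDerivAt_laplacian : ∀ r, r₀ ≤ r → HasDerivAt D (r / 4 * A r) r

/-- The energy of a solution of the radial system. The powers of `r` are those for which all terms
of a solution of size `exp (-c r^{4/3})` are of the same order. -/
def radialEnergy (A B D : ℝ → ℝ) (r : ℝ) : ℝ :=
  r ^ (4 / 3 : ℝ) * A r ^ 2 + r ^ (2 / 3 : ℝ) * B r ^ 2 + D r ^ 2

lemma monotoneOn_mul_exp_of_neg_mul_le_deriv {s : Set ℝ} (hs : Convex ℝ s) {f f' φ φ' : ℝ → ℝ}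
    (hf : ∀ r ∈ s, HasDerivAt f (f' r) r) (hφ : ∀ r ∈ s, HasDerivAt φ (φ' r) r)
    (hle : ∀ r ∈ s, -(φ' r * f r) ≤ f' r) : MonotoneOn (fun r => f r * Real.exp (φ r)) s := by
  have hderiv : ∀ r ∈ s, HasDerivAt (fun r => f r * Real.exp (φ r))
      (f' r * Real.exp (φ r) + f r * (Real.exp (φ r) * φ' r)) r :=
    fun r hr => (hf r hr).mul (hφ r hr).exp
  refine monotoneOn_of_deriv_nonneg hs (fun r hr => (hderiv r hr).continuousAt.continuousWithinAt)
    (fun r hr => (hderiv r (interior_subset hr)).differentiableAt.differentiableWithinAt)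
    fun r hr => ?_
  rw [(hderiv r (interior_subset hr)).deriv]
  have := mul_nonneg (neg_le_iff_add_nonneg.1 (hle r (interior_subset hr))) (Real.exp_pos (φ r)).le
  linarith

lemma neg_mul_sum_sq_le {f l q : ℝ} (hl : 0 ≤ l) (hq : 0 ≤ q) (hf : f ≤ q * l) (a b c : ℝ) :
    -((3 + 2 * q) * l * (a ^ 2 + b ^ 2 + c ^ 2)) ≤
      l * (2 * (a * b + b * c) + a * c / 2) - 2 * f * b ^ 2 := by
  have hcross : -(3 * (a ^ 2 + b ^ 2 + c ^ 2)) ≤ 2 * (a * b + b * c) + a * c / 2 := by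
    nlinarith [sq_nonneg (a + b), sq_nonneg (b + c), sq_nonneg (a + c), sq_nonneg a, sq_nonneg b,
      sq_nonneg c]
  have hfriction : f * b ^ 2 ≤ q * l * (a ^ 2 + b ^ 2 + c ^ 2) :=
    mul_le_mul hf (by nlinarith [sq_nonneg a, sq_nonneg c]) (sq_nonneg b) (by positivity)
  linear_combination l * hcross + 2 * hfriction

/-- The rate at which the energy of a solution of the radial system may decay. -/
def radialRate (n r₀ : ℝ) : ℝ := 3 + 2 * n * (r₀ ^ (4 / 3 : ℝ))⁻¹

variable {A B D : ℝ → ℝ} {n r₀ : ℝ}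

lemma RadialSystem.mono (h : RadialSystem n r₀ A B D) {r₁ : ℝ} (hr : r₀ ≤ r₁) :
    RadialSystem n r₁ A B D where
  hasDerivAt_profile r h' := h.hasDerivAt_profile r (hr.trans h')
  hasDerivAt_slope r h' := h.hasDerivAt_slope r (hr.trans h')
  hasDerivAt_laplacian r h' := h.hasDerivAt_laplacian r (hr.trans h')

/-- With `l = r^{1/3}`, the quadratic form in the derivative of the energy is a form in
`l² A`, `l B` and `D` with coefficients of order `l`. -/
lemma neg_radialRate_mul_radialEnergy_le (hn : 0 ≤ n) (hr₀ : 0 < r₀) {r : ℝ} (hr : r₀ ≤ r) :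
    -(radialRate n r₀ * (4 / 3 * r ^ (1 / 3 : ℝ)) * radialEnergy A B D r) ≤
      (4 / 3 * r ^ (1 / 3 : ℝ) * A r ^ 2 + r ^ (4 / 3 : ℝ) * (2 * A r * B r)) +
        (2 / 3 * r ^ (-1 / 3 : ℝ) * B r ^ 2 +
          r ^ (2 / 3 : ℝ) * (2 * B r * (D r - n / r * B r))) + 2 * D r * (r / 4 * A r) := by
  have hr_pos : 0 < r := hr₀.trans_le hr
  set l := r ^ (1 / 3 : ℝ)
  have hl : 0 < l := Real.rpow_pos_of_pos hr_pos _
  have hpow : ∀ k : ℕ, r ^ (k / 3 : ℝ) = l ^ k := fun k => by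
    rw [← Real.rpow_natCast, ← Real.rpow_mul hr_pos.le]
    congr 1
    ring
  have hl4 : r ^ (4 / 3 : ℝ) = l ^ 4 := mod_cast hpow 4
  have hl2 : r ^ (2 / 3 : ℝ) = l ^ 2 := mod_cast hpow 2
  have hl3 : r = l ^ 3 := by simpa using hpow 3
  set q := n * (r₀ ^ (4 / 3 : ℝ))⁻¹ with hq_def
  have hq : 0 ≤ q := by positivity
  have hfriction : n / r ≤ q * l := by
    have hr₀l : r₀ ^ (4 / 3 : ℝ) ≤ l ^ 4 := hl4 ▸ Real.rpow_le_rpow hr₀.le hr (by norm_num)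
    calc n / r = n * (l ^ 4)⁻¹ * l := by
          rw [hl3]
          field_simp
      _ ≤ q * l := by
          rw [hq_def]
          gcongr
  have hrate : radialRate n r₀ = 3 + 2 * q := by rw [radialRate, hq_def, mul_assoc]
  rw [radialEnergy, hrate, hl4, hl2]
  have hform := neg_mul_sum_sq_le hl.le hq hfriction (l ^ 2 * A r) (l * B r) (D r)
  have hA : 0 ≤ 4 / 3 * l * A r ^ 2 := by positivity
  have hB : 0 ≤ 2 / 3 * r ^ (-1 / 3 : ℝ) * B r ^ 2 := by positivity
  have henergy : 0 ≤ (3 + 2 * q) * l * (l ^ 4 * A r ^ 2 + l ^ 2 * B r ^ 2 + D r ^ 2) := by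
    positivity
  have hD : 2 * D r * (r / 4 * A r) = l * (l ^ 2 * A r * D r / 2) := by
    nth_rewrite 2 [hl3]
    ring
  rw [hD]
  linear_combination hform + hA + hB + 1 / 3 * henergy

lemma RadialSystem.radialEnergy_ge (h : RadialSystem n r₀ A B D) (hn : 0 ≤ n) (hr₀ : 0 < r₀)
    {r : ℝ} (hr : r₀ ≤ r) :
    r₀ ^ (4 / 3 : ℝ) * A r₀ ^ 2 * Real.exp (-(radialRate n r₀ * r ^ (4 / 3 : ℝ))) ≤
      radialEnergy A B D r := by
  have hmono : MonotoneOn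
      (fun r => radialEnergy A B D r * Real.exp (radialRate n r₀ * r ^ (4 / 3 : ℝ))) (Ici r₀) := by
    refine monotoneOn_mul_exp_of_neg_mul_le_deriv (convex_Ici r₀) (fun r hr => ?_) (fun r hr => ?_)
      fun r hr => neg_radialRate_mul_radialEnergy_le hn hr₀ hr
    all_goals have hr_ne : r ≠ 0 := (hr₀.trans_le hr).ne'
    · have h43 := Real.hasDerivAt_rpow_const (p := 4 / 3) (Or.inl hr_ne)
      have h23 := Real.hasDerivAt_rpow_const (p := 2 / 3) (Or.inl hr_ne)
      refine (((h43.mul ((h.hasDerivAt_profile r hr).pow 2)).add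
        (h23.mul ((h.hasDerivAt_slope r hr).pow 2))).add
        ((h.hasDerivAt_laplacian r hr).pow 2)).congr_deriv ?_
      norm_num
    · refine ((Real.hasDerivAt_rpow_const (p := 4 / 3) (Or.inl hr_ne)).const_mul _).congr_deriv ?_
      norm_num
  have hr₀_rate : 0 ≤ radialRate n r₀ := by
    unfold radialRate
    positivity
  have hstart : r₀ ^ (4 / 3 : ℝ) * A r₀ ^ 2 ≤
      radialEnergy A B D r₀ * Real.exp (radialRate n r₀ * r₀ ^ (4 / 3 : ℝ)) := by
    have hle : r₀ ^ (4 / 3 : ℝ) * A r₀ ^ 2 ≤ radialEnergy A B D r₀ := by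
      rw [radialEnergy, add_assoc]
      exact le_add_of_nonneg_right (by positivity)
    exact hle.trans (le_mul_of_one_le_right ((by positivity : (0 : ℝ) ≤ _).trans hle)
      (Real.one_le_exp (by positivity)))
  rw [Real.exp_neg, ← div_eq_mul_inv, div_le_iff₀ (Real.exp_pos _)]
  exact hstart.trans (hmono self_mem_Ici hr hr)

/-- The factor by which the energy may exceed the square root of the profile on a short interval. -/
def radialConst (n : ℝ) (M₁ M₂ : ℝ≥0) : ℝ :=
  1 + (2 + M₁) ^ 2 + ((2 + 3 * n) * (2 + M₁) + M₂) ^ 2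

lemma RadialSystem.abs_slope_le (h : RadialSystem n r₀ A B D) {M₁ : ℝ≥0}
    (hB : LipschitzWith M₁ B) {δ : ℝ} (hδ : 0 < δ) (hA : |A r₀| ≤ δ ^ 4)
    (hA' : |A (r₀ + δ ^ 2)| ≤ δ ^ 4) : |B r₀| ≤ (2 + M₁) * δ ^ 2 := by
  have hosc : ∀ u ∈ Icc r₀ (r₀ + δ ^ 2), ‖B u - B r₀‖ ≤ M₁ * δ ^ 2 := by
    refine fun u hu => (hB.norm_sub_le u r₀).trans ?_
    gcongr
    rw [Real.norm_of_nonneg (sub_nonneg.2 hu.1)]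
    linarith [hu.2]
  have := norm_deriv_le_of_norm_le_of_norm_sub_le (by positivity)
    (fun u hu => h.hasDerivAt_profile u hu.1) hosc hA hA'
  refine this.trans_eq ?_
  field_simp

lemma RadialSystem.abs_laplacian_le (h : RadialSystem n r₀ A B D) (hn : 0 ≤ n) (hr₀ : 1 ≤ r₀)
    {M₂ : ℝ≥0} (hD : LipschitzWith M₂ D) {b δ : ℝ} (hδ : 0 < δ) (hδ1 : δ ≤ 1)
    (hB : ∀ u ∈ Icc r₀ (r₀ + δ), |B u| ≤ b * δ ^ 2) :
    |D r₀| ≤ ((2 + 3 * n) * b + M₂) * δ := by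
  have hr₀_mem : r₀ ∈ Icc r₀ (r₀ + δ) := left_mem_Icc.2 (by linarith)
  have hfriction : ∀ u ∈ Icc r₀ (r₀ + δ), |n / u * B u| ≤ n * (b * δ ^ 2) := by
    intro u hu
    have hu1 : 1 ≤ u := hr₀.trans hu.1
    rw [abs_mul, abs_of_nonneg (by positivity)]
    exact mul_le_mul (div_le_self hn hu1) (hB u hu) (abs_nonneg _) hn
  have hosc : ∀ u ∈ Icc r₀ (r₀ + δ), ‖D u - n / u * B u - (D r₀ - n / r₀ * B r₀)‖ ≤
      M₂ * δ + 2 * (n * (b * δ ^ 2)) := by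
    intro u hu
    have hDu : |D u - D r₀| ≤ M₂ * δ := by
      refine (hD.norm_sub_le u r₀).trans ?_
      gcongr
      rw [Real.norm_of_nonneg (sub_nonneg.2 hu.1)]
      linarith [hu.2]
    calc ‖D u - n / u * B u - (D r₀ - n / r₀ * B r₀)‖
        = |D u - D r₀ - n / u * B u + n / r₀ * B r₀| := by
          rw [Real.norm_eq_abs]
          congr 1
          ring
      _ ≤ |D u - D r₀| + |n / u * B u| + |n / r₀ * B r₀| :=
          (abs_add_le _ _).trans (by gcongr; exact abs_sub _ _)
      _ ≤ M₂ * δ + 2 * (n * (b * δ ^ 2)) := by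
          linarith [hfriction u hu, hfriction r₀ hr₀_mem]
  have hslope := norm_deriv_le_of_norm_le_of_norm_sub_le hδ
    (fun u hu => h.hasDerivAt_slope u hu.1) hosc (hB r₀ hr₀_mem)
    (hB (r₀ + δ) (right_mem_Icc.2 (by linarith)))
  have hb : 0 ≤ b := nonneg_of_mul_nonneg_left ((abs_nonneg _).trans (hB r₀ hr₀_mem))
    (by positivity)
  calc |D r₀| = |D r₀ - n / r₀ * B r₀ + n / r₀ * B r₀| := by rw [sub_add_cancel]
    _ ≤ 2 * (b * δ ^ 2) / δ + (M₂ * δ + 2 * (n * (b * δ ^ 2))) + n * (b * δ ^ 2) :=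
        (abs_add_le _ _).trans (add_le_add hslope (hfriction r₀ hr₀_mem))
    _ = (2 * b + M₂) * δ + 3 * (n * b * δ) * δ := by
        field_simp
        ring
    _ ≤ (2 * b + M₂) * δ + 3 * (n * b * δ) * 1 := by gcongr
    _ = ((2 + 3 * n) * b + M₂) * δ := by ring

lemma RadialSystem.radialEnergy_le (h : RadialSystem n r₀ A B D) (hn : 0 ≤ n) (hr₀ : 1 ≤ r₀)
    {M₁ M₂ : ℝ≥0} (hB : LipschitzWith M₁ B) (hD : LipschitzWith M₂ D) {δ : ℝ} (hδ : 0 < δ)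
    (hδ1 : δ ≤ 1) (hA : ∀ u ∈ Icc r₀ (r₀ + 2 * δ), |A u| ≤ δ ^ 4) :
    radialEnergy A B D r₀ ≤ r₀ ^ (4 / 3 : ℝ) * (radialConst n M₁ M₂ * δ ^ 2) := by
  have hδ_sq : δ ^ 2 ≤ δ := by nlinarith
  have hslope : ∀ u ∈ Icc r₀ (r₀ + δ), |B u| ≤ (2 + M₁) * δ ^ 2 := fun u hu =>
    (h.mono hu.1).abs_slope_le hB hδ (hA u ⟨hu.1, by linarith [hu.2]⟩)
      (hA _ ⟨by nlinarith [hu.1], by linarith [hu.2]⟩)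
  have hlaplacian := h.abs_laplacian_le hn hr₀ hD hδ hδ1 hslope
  have hr₀_mem : r₀ ∈ Icc r₀ (r₀ + δ) := left_mem_Icc.2 (by linarith)
  have hA_sq : A r₀ ^ 2 ≤ δ ^ 2 := by
    refine sq_le_sq.2 ((hA r₀ (left_mem_Icc.2 (by linarith))).trans ?_)
    rw [abs_of_pos hδ]
    exact pow_le_of_le_one hδ.le hδ1 (by norm_num)
  have hB_sq : B r₀ ^ 2 ≤ ((2 + M₁) * δ) ^ 2 := by
    refine sq_le_sq.2 ((hslope r₀ hr₀_mem).trans ?_)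
    rw [abs_of_nonneg (by positivity)]
    gcongr
  have hD_sq : D r₀ ^ 2 ≤ (((2 + 3 * n) * (2 + M₁) + M₂) * δ) ^ 2 := by
    refine sq_le_sq.2 (hlaplacian.trans_eq (abs_of_nonneg ?_).symm)
    positivity
  have hp : r₀ ^ (2 / 3 : ℝ) ≤ r₀ ^ (4 / 3 : ℝ) :=
    Real.rpow_le_rpow_of_exponent_le hr₀ (by norm_num)
  have hp1 : 1 ≤ r₀ ^ (4 / 3 : ℝ) := Real.one_le_rpow hr₀ (by norm_num)
  calc radialEnergy A B D r₀
      ≤ r₀ ^ (4 / 3 : ℝ) * δ ^ 2 + r₀ ^ (4 / 3 : ℝ) * ((2 + M₁) * δ) ^ 2 +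
        r₀ ^ (4 / 3 : ℝ) * (((2 + 3 * n) * (2 + M₁) + M₂) * δ) ^ 2 := by
        unfold radialEnergy
        gcongr
        exact hD_sq.trans (le_mul_of_one_le_left (by positivity) hp1)
    _ = r₀ ^ (4 / 3 : ℝ) * (radialConst n M₁ M₂ * δ ^ 2) := by
        unfold radialConst
        ring

lemma mul_sq_mul_exp_le_half {N L p κ μ : ℝ} (hN : 0 < N) (hL : 0 ≤ L) (hp : 0 ≤ p) (hκ : 0 < κ)
    (hκ1 : κ ≤ 1) (hκμ : κ ≤ μ / (2 * N)) :
    p * (N * (κ * Real.exp (-(L + 1) * p)) ^ 2) ≤ μ / 2 * Real.exp (-(L * p)) := by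
  set δ := κ * Real.exp (-(L + 1) * p) with hδ_def
  have hδ : 0 < δ := by positivity
  have hδ1 : δ ≤ 1 :=
    (mul_le_of_le_one_right hκ.le (Real.exp_le_one_iff.2 (by nlinarith))).trans hκ1
  calc p * (N * δ ^ 2) ≤ Real.exp p * (N * δ) := by
        gcongr
        · linarith [Real.add_one_le_exp p]
        · nlinarith
    _ = N * κ * Real.exp (-(L * p)) := by
        rw [hδ_def, show -(L * p) = -(L + 1) * p + p by ring, Real.exp_add]
        ring
    _ ≤ N * (μ / (2 * N)) * Real.exp (-(L * p)) := by gcongr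
    _ = μ / 2 * Real.exp (-(L * p)) := by field_simp

/-- The energy argument forbids the profile to be too small on an interval of length `ε`; the rate
`K` does not depend on `ε`. -/
lemma exists_le_abs_of_radialSystem {m : ℝ} (M₁ M₂ : ℝ≥0) (hn : 0 ≤ n) (hr₀ : 0 < r₀)
    (hr₀1 : r₀ ≤ 1) (hm : 0 < m) : ∃ K : ℝ, 0 < K ∧ ∀ ε : ℝ, 0 < ε → ∃ c : ℝ, 0 < c ∧
      ∀ A B D : ℝ → ℝ, RadialSystem n r₀ A B D → LipschitzWith M₁ B → LipschitzWith M₂ D →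
      m ≤ A r₀ → ∀ r, 1 ≤ r →
      ∃ u ∈ Icc r (r + ε), c * Real.exp (-K * r ^ (4 / 3 : ℝ)) ≤ |A u| := by
  set N := radialConst n M₁ M₂ with hN_def
  have hN : 0 < N := by
    rw [hN_def, radialConst]
    positivity
  set L := radialRate n r₀ with hL_def
  have hL : 0 < L := by
    rw [hL_def, radialRate]
    positivity
  set μ := r₀ ^ (4 / 3 : ℝ) * m ^ 2 with hμ_def
  have hμ : 0 < μ := by positivity
  refine ⟨4 * (L + 1), by positivity, fun ε hε => ?_⟩
  obtain ⟨κ, hκ, hκ1, hκε, hκμ⟩ : ∃ κ : ℝ, 0 < κ ∧ κ ≤ 1 ∧ κ ≤ ε / 2 ∧ κ ≤ μ / (2 * N) :=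
    ⟨min 1 (min (ε / 2) (μ / (2 * N))), by positivity, min_le_left _ _,
      (min_le_right _ _).trans (min_le_left _ _), (min_le_right _ _).trans (min_le_right _ _)⟩
  refine ⟨κ ^ 4, by positivity, fun A B D h hB hD hmA r hr => ?_⟩
  by_contra! hsmall
  set p := r ^ (4 / 3 : ℝ)
  have hp : 0 ≤ p := by positivity
  set δ := κ * Real.exp (-(L + 1) * p) with hδ_def
  have hδ : 0 < δ := by positivity
  have hδκ : δ ≤ κ := mul_le_of_le_one_right hκ.le (Real.exp_le_one_iff.2 (by nlinarith))
  have hδ_pow : κ ^ 4 * Real.exp (-(4 * (L + 1)) * p) = δ ^ 4 := by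
    rw [hδ_def, mul_pow, ← Real.exp_nat_mul]
    congr 2
    push_cast
    ring
  rw [hδ_pow] at hsmall
  have hupper : radialEnergy A B D r ≤ p * (N * δ ^ 2) :=
    (h.mono (hr₀1.trans hr)).radialEnergy_le hn hr hB hD hδ (hδκ.trans hκ1)
      fun u hu => (hsmall u ⟨hu.1, by linarith [hu.2]⟩).le
  have hlower : μ * Real.exp (-(L * p)) ≤ radialEnergy A B D r := by
    refine le_trans ?_ (h.radialEnergy_ge hn hr₀ (hr₀1.trans hr))
    rw [hμ_def]
    gcongr
  have habsorb : p * (N * δ ^ 2) ≤ μ / 2 * Real.exp (-(L * p)) :=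
    mul_sq_mul_exp_le_half hN hL.le hp hκ hκ1 hκμ
  nlinarith [mul_pos hμ (Real.exp_pos (-(L * p)))]

end RadialSystem

section LowerBound

open scoped SchwartzMap LineDeriv Laplacian

variable {d : ℕ} {V : Type*} [NormedAddCommGroup V]

/-- The weight `exp (-c |x|^{4/3})`, which up to the value of `c` is the exact order of decay of the
kernel. -/
def weight (c : ℝ) (x : V) : ℝ := Real.exp (-c * ‖x‖ ^ (4 / 3 : ℝ))

lemma weight_pos (c : ℝ) (x : V) : 0 < weight c x := Real.exp_pos _

lemma weight_le_one {c : ℝ} (hc : 0 ≤ c) (x : V) : weight c x ≤ 1 := by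
  refine Real.exp_le_one_iff.2 (mul_nonpos_of_nonpos_of_nonneg (neg_nonpos.2 hc) ?_)
  positivity

lemma weight_natCast_mul (n : ℕ) (c : ℝ) (x : V) : weight (n * c) x = weight c x ^ n := by
  rw [weight, weight, ← Real.exp_nat_mul]
  congr 1
  ring

lemma dist_smul_inv_norm_smul [NormedSpace ℝ V] {z : V} (hz : ‖z‖ ≠ 0) (u : ℝ) :
    dist (u • ‖z‖⁻¹ • z) z = |u - ‖z‖| := by
  have hsub : u • ‖z‖⁻¹ • z - z = (u - ‖z‖) • ‖z‖⁻¹ • z := by rw [sub_smul, smul_inv_smul₀ hz]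
  rw [dist_eq_norm, hsub, norm_smul, norm_smul, norm_inv, norm_norm, inv_mul_cancel₀ hz, mul_one,
    Real.norm_eq_abs]

lemma exists_half_green_one_zero_lt (d : ℕ) :
    ∃ δ > 0, ∀ x : E d, ‖x‖ < δ → green d 1 0 / 2 < green d 1 x := by
  have hnear := ((continuous_green (d := d) one_pos).tendsto 0).eventually
    (lt_mem_nhds (half_lt_self (green_zero_pos one_pos)))
  obtain ⟨δ, hδ, h⟩ := Metric.eventually_nhds_iff.1 hnear
  exact ⟨δ, hδ, fun x hx => h (by simpa using hx)⟩

lemma radialSystem_green {e : E d} (he : ‖e‖ = 1) {r₀ : ℝ} (hr₀ : 0 < r₀) :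
    RadialSystem (d - 1) r₀ (fun r => green d 1 (r • e)) (fun r => fderiv ℝ (green d 1) (r • e) e)
      fun r => (Δ (greenSchwartz d one_pos) (r • e)).re where
  hasDerivAt_profile r _ := by
    simpa using hasDerivAt_comp_add_smul (differentiable_green (d := d) one_pos) 0 e r
  hasDerivAt_slope r hr := by
    have hr_pos : 0 < r := hr₀.trans_le hr
    have hderiv := Complex.reCLM.hasFDerivAt.comp_hasDerivAt r
      (hasDerivAt_schwartz_line (∂_{e} (greenSchwartz d one_pos)) 0 e r)
    simp only [zero_add, Function.comp_def, Complex.reCLM_apply, lineDerivOp_greenSchwartz _ e,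
      Complex.ofReal_re] at hderiv
    have hray := congrArg Complex.re
      ((isRotationInvariant_greenSchwartz (d := d)).laplacian_ray he r)
    rw [lineDerivOp_greenSchwartz, finrank_euclideanSpace_fin, Complex.re_ofReal_mul,
      Complex.add_re, Complex.re_ofReal_mul, ← Complex.ofReal_natCast, ← Complex.ofReal_one,
      ← Complex.ofReal_sub, ← Complex.ofReal_mul, Complex.ofReal_re] at hray
    refine hderiv.congr_deriv ?_
    field_simp
    linarith
  hasDerivAt_laplacian r _ := by
    have h := Complex.reCLM.hasFDerivAt.comp_hasDerivAt r
      (hasDerivAt_schwartz_line (Δ (greenSchwartz d one_pos)) 0 e r)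
    simp only [zero_add, lineDerivOp_laplacian_greenSchwartz, greenSchwartz_eq_ofReal] at h
    refine h.congr_deriv ?_
    rw [← Complex.ofReal_mul, Complex.reCLM_apply, Complex.ofReal_re, real_inner_smul_left,
      real_inner_self_eq_norm_sq, he]
    ring

lemma exists_le_abs_green_one_ray (hd : 1 ≤ d) : ∃ K : ℝ, 0 < K ∧ ∀ ε : ℝ, 0 < ε →
    ∃ c : ℝ, 0 < c ∧ ∀ e : E d, ‖e‖ = 1 → ∀ r : ℝ, 1 ≤ r →
      ∃ u ∈ Icc r (r + ε), c * Real.exp (-K * r ^ (4 / 3 : ℝ)) ≤ |green d 1 (u • e)| := by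
  obtain ⟨M₁, hM₁⟩ := exists_lipschitzWith_fderiv_green (d := d) one_pos
  obtain ⟨M₂, hM₂⟩ := exists_lipschitzWith_schwartz (Δ (greenSchwartz d one_pos))
  obtain ⟨δ, hδ, hcenter⟩ := exists_half_green_one_zero_lt d
  have hn : (0 : ℝ) ≤ d - 1 := sub_nonneg.2 (mod_cast hd)
  have hr₀ : 0 < min 1 (δ / 2) := by positivity
  obtain ⟨K, hK, h⟩ := exists_le_abs_of_radialSystem M₁ M₂ hn hr₀ (min_le_left _ _)
    (half_pos (green_zero_pos (d := d) one_pos))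
  refine ⟨K, hK, fun ε hε => ?_⟩
  obtain ⟨c, hc, h⟩ := h ε hε
  refine ⟨c, hc, fun e he => h _ _ _ (radialSystem_green he hr₀) ?_ ?_ (hcenter _ ?_).le⟩
  · refine LipschitzWith.of_dist_le_mul fun u v => ?_
    have happly := (fderiv ℝ (green d 1) (u • e) - fderiv ℝ (green d 1) (v • e)).le_opNorm e
    rw [he, mul_one] at happly
    refine happly.trans ((hM₁.norm_sub_le _ _).trans_eq ?_)
    rw [← sub_smul, norm_smul, he, mul_one, dist_eq_norm]
  · refine LipschitzWith.of_dist_le_mul fun u v => ?_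
    rw [Real.dist_eq, ← Complex.sub_re]
    refine (Complex.abs_re_le_norm _).trans ((hM₂.norm_sub_le _ _).trans_eq ?_)
    rw [← sub_smul, norm_smul, he, mul_one, dist_eq_norm]
  · rw [norm_smul, he, mul_one, Real.norm_of_nonneg hr₀.le]
    exact (min_le_right _ _).trans_lt (half_lt_self hδ)

lemma ofReal_mul_measure_ball_le_lintegral {V F : Type*} [PseudoMetricSpace V] [MeasurableSpace V]
    [OpensMeasurableSpace V] [SeminormedAddCommGroup F] (μ : Measure V) {f : V → F} {M : ℝ≥0}
    (hf : LipschitzWith M f) {z : V} {b ρ : ℝ} (hb : b ≤ ‖f z‖) (hρ : M * ρ ≤ b / 2) :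
    ENNReal.ofReal (b / 2) * μ (Metric.ball z ρ) ≤ ∫⁻ w in Metric.ball z ρ, ‖f w‖ₑ ∂μ := by
  rw [← setLIntegral_const]
  refine setLIntegral_mono' measurableSet_ball fun w hw => ?_
  rw [← ofReal_norm]
  refine ENNReal.ofReal_le_ofReal ?_
  have hzw : dist (f z) (f w) ≤ M * ρ := by
    refine (hf.dist_le_mul z w).trans ?_
    gcongr
    exact (dist_comm z w).trans_le (Metric.mem_ball.1 hw).le
  linarith [norm_sub_norm_le (f z) (f w), dist_eq_norm (f z) (f w)]

lemma exists_le_lintegral_green_one (hd : 1 ≤ d) : ∃ K : ℝ, 0 < K ∧ ∀ ε : ℝ, 0 < ε →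
    ∃ c : ℝ, 0 < c ∧ ∀ z : E d, 1 ≤ ‖z‖ →
      ENNReal.ofReal (c * weight K z) ≤ ∫⁻ w in Metric.ball z ε, ‖green d 1 w‖ₑ := by
  obtain ⟨K, hK, hray⟩ := exists_le_abs_green_one_ray hd
  refine ⟨(d + 1) * K, by positivity, fun ε hε => ?_⟩
  obtain ⟨M, hM⟩ := exists_lipschitzWith_green (d := d) one_pos
  obtain ⟨c, hc, hray⟩ := hray (ε / 2) (half_pos hε)
  obtain ⟨β, hβ, hβε, hβM⟩ : ∃ β : ℝ, 0 < β ∧ β ≤ ε / 2 ∧ β ≤ c / (2 * (M + 1)) :=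
    ⟨min (ε / 2) (c / (2 * (M + 1))), by positivity, min_le_left _ _, min_le_right _ _⟩
  set ω := (volume (Metric.ball (0 : E d) 1)).toReal
  have hω : 0 < ω := ENNReal.toReal_pos (Metric.measure_ball_pos _ _ one_pos).ne'
    measure_ball_lt_top.ne
  refine ⟨c / 2 * (β ^ d * ω), by positivity, fun z hz => ?_⟩
  have hz_pos : 0 < ‖z‖ := one_pos.trans_le hz
  obtain ⟨u, hu, hgreen⟩ := hray (‖z‖⁻¹ • z)
    (by rw [norm_smul, norm_inv, norm_norm, inv_mul_cancel₀ hz_pos.ne']) ‖z‖ hz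
  set z' := u • ‖z‖⁻¹ • z
  set x := weight K z
  have hx : 0 < x := weight_pos K z
  have hρ : 0 < β * x := by positivity
  have hzz' : dist z' z ≤ ε / 2 := by
    rw [dist_smul_inv_norm_smul hz_pos.ne', abs_of_nonneg (sub_nonneg.2 hu.1)]
    linarith [hu.2]
  have hsubset : Metric.ball z' (β * x) ⊆ Metric.ball z ε := by
    refine Metric.ball_subset_ball' ?_
    linarith [mul_le_of_le_one_right hβ.le (weight_le_one hK.le z)]
  have hosc : M * (β * x) ≤ c * x / 2 := by
    have hMβ : (M + 1) * β ≤ c / 2 := by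
      rw [le_div_iff₀ (by positivity)] at hβM
      linarith
    nlinarith
  have hpow : weight ((d + 1) * K) z = x ^ (d + 1) := mod_cast weight_natCast_mul (d + 1) K z
  calc ENNReal.ofReal (c / 2 * (β ^ d * ω) * weight ((d + 1) * K) z)
      = ENNReal.ofReal (c * x / 2) * volume (Metric.ball z' (β * x)) := by
        rw [Measure.addHaar_ball_of_pos volume z' hρ, finrank_euclideanSpace_fin,
          ← ENNReal.ofReal_toReal (measure_ball_lt_top (μ := (volume : Measure (E d)))
            (x := 0) (r := 1)).ne, ← ENNReal.ofReal_mul (by positivity),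
          ← ENNReal.ofReal_mul (by positivity), hpow]
        congr 1
        ring
    _ ≤ ∫⁻ w in Metric.ball z' (β * x), ‖green d 1 w‖ₑ :=
        ofReal_mul_measure_ball_le_lintegral volume hM hgreen hosc
    _ ≤ ∫⁻ w in Metric.ball z ε, ‖green d 1 w‖ₑ := lintegral_mono_set hsubset

end LowerBound

section WeightIntegrable

variable {d : ℕ}

lemma continuous_weight {V : Type*} [NormedAddCommGroup V] (c : ℝ) :
    Continuous (weight c : V → ℝ) := by
  unfold weight
  fun_prop (disch := norm_num)

lemma weight_anti {V : Type*} [NormedAddCommGroup V] {b c : ℝ} (h : b ≤ c) (x : V) :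
    weight c x ≤ weight b x := by
  unfold weight
  gcongr

lemma weight_smul {V : Type*} [NormedAddCommGroup V] [NormedSpace ℝ V] (c : ℝ) {a : ℝ}
    (ha : 0 ≤ a) (x : V) : weight c (a • x) = weight (c * a ^ (4 / 3 : ℝ)) x := by
  rw [weight, weight, norm_smul, Real.norm_of_nonneg ha, Real.mul_rpow ha (norm_nonneg x)]
  ring_nf

lemma norm_add_rpow_le {V : Type*} [NormedAddCommGroup V] (x y : V) :
    ‖x + y‖ ^ (4 / 3 : ℝ) ≤ 2 * (‖x‖ ^ (4 / 3 : ℝ) + ‖y‖ ^ (4 / 3 : ℝ)) := by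
  have hconvex : (‖x‖ + ‖y‖) ^ (4 / 3 : ℝ) ≤
      2 ^ (4 / 3 - 1 : ℝ) * (‖x‖ ^ (4 / 3 : ℝ) + ‖y‖ ^ (4 / 3 : ℝ)) :=
    mod_cast NNReal.rpow_add_le_mul_rpow_add_rpow ‖x‖₊ ‖y‖₊ (by norm_num : (1 : ℝ) ≤ 4 / 3)
  have htwo : (2 : ℝ) ^ (4 / 3 - 1 : ℝ) ≤ 2 :=
    (Real.rpow_le_rpow_of_exponent_le one_le_two (by norm_num)).trans_eq (Real.rpow_one 2)
  calc ‖x + y‖ ^ (4 / 3 : ℝ)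
      ≤ (‖x‖ + ‖y‖) ^ (4 / 3 : ℝ) := by gcongr; exact norm_add_le x y
    _ ≤ 2 ^ (4 / 3 - 1 : ℝ) * (‖x‖ ^ (4 / 3 : ℝ) + ‖y‖ ^ (4 / 3 : ℝ)) := hconvex
    _ ≤ 2 * (‖x‖ ^ (4 / 3 : ℝ) + ‖y‖ ^ (4 / 3 : ℝ)) := by gcongr

lemma weight_mul_weight_sub_le {V : Type*} [NormedAddCommGroup V] {c : ℝ} (hc : 0 ≤ c) (x y : V) :
    weight c x * weight c (y - x) ≤ weight (c / 2) y := by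
  rw [weight, weight, weight, ← Real.exp_add, Real.exp_le_exp]
  have := norm_add_rpow_le x (y - x)
  rw [add_sub_cancel] at this
  nlinarith

lemma weight_sub_le {V : Type*} [NormedAddCommGroup V] {c : ℝ} (hc : 0 ≤ c) (x y : V) :
    weight c (x - y) ≤ (weight c x)⁻¹ * weight (c / 2) y := by
  have hsymm : weight c (x - y) = weight c (y - x) := by rw [weight, weight, norm_sub_rev]
  rw [inv_mul_eq_div, le_div_iff₀' (weight_pos c x), hsymm]
  exact weight_mul_weight_sub_le hc x y

lemma lowerSemicontinuous_lintegral {X α : Type*} [TopologicalSpace X] [FirstCountableTopology X]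
    [MeasurableSpace α] {μ : Measure α} {f : X → α → ℝ≥0∞} (hmeas : ∀ x, AEMeasurable (f x) μ)
    (hf : ∀ a, LowerSemicontinuous fun x => f x a) :
    LowerSemicontinuous fun x => ∫⁻ a, f x a ∂μ :=
  lowerSemicontinuous_iff_le_liminf.2 fun x =>
    (lintegral_mono fun a => (hf a).le_liminf x).trans (lintegral_liminf_le' hmeas)

lemma exists_forall_mem_ball_le_natCast {X : Type*} [PseudoMetricSpace X] [BaireSpace X]
    [Nonempty X] {F : X → ℝ≥0∞} (hF : LowerSemicontinuous F) (hfin : ∀ x, F x ≠ ∞) :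
    ∃ x₀, ∃ ε > 0, ∃ n : ℕ, ∀ x ∈ Metric.ball x₀ ε, F x ≤ n := by
  have hunion : ⋃ n : ℕ, F ⁻¹' Iic (n : ℝ≥0∞) = univ := by
    refine eq_univ_of_forall fun x => mem_iUnion.2 ?_
    obtain ⟨n, hn⟩ := ENNReal.exists_nat_gt (hfin x)
    exact ⟨n, hn.le⟩
  obtain ⟨n, x₀, hx₀⟩ := nonempty_interior_of_iUnion_of_closed
    (fun n : ℕ => hF.isClosed_preimage (n : ℝ≥0∞)) hunion
  obtain ⟨ε, hε, hsub⟩ := Metric.isOpen_iff.1 isOpen_interior x₀ hx₀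
  exact ⟨x₀, ε, hε, n, fun x hx => (interior_subset (hsub hx) : x ∈ F ⁻¹' Iic (n : ℝ≥0∞))⟩

lemma lintegral_mul_lintegral_ball_sub {V : Type*} [NormedAddCommGroup V] [MeasurableSpace V]
    [BorelSpace V] [SecondCountableTopology V] {μ : Measure V} [SFinite μ]
    [μ.IsAddRightInvariant] {g k : V → ℝ≥0∞} (hg : Measurable g) (hk : AEMeasurable k μ) (x₀ : V)
    (ε : ℝ) : ∫⁻ y, k y * ∫⁻ w in Metric.ball (x₀ - y) ε, g w ∂μ ∂μ =
      ∫⁻ x in Metric.ball x₀ ε, ∫⁻ y, g (x - y) * k y ∂μ ∂μ := by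
  have htranslate : ∀ y, ∫⁻ w in Metric.ball (x₀ - y) ε, g w ∂μ =
      ∫⁻ x in Metric.ball x₀ ε, g (x - y) ∂μ := by
    intro y
    rw [← (measurePreserving_sub_right μ y).setLIntegral_comp_preimage measurableSet_ball hg]
    congr 2
    ext x
    simp only [mem_preimage, Metric.mem_ball, dist_sub_right]
  rw [lintegral_lintegral_swap ((hg.comp (measurable_fst.sub measurable_snd)).aemeasurable.mul
    hk.comp_snd)]
  refine lintegral_congr fun y => ?_
  rw [htranslate, mul_comm, lintegral_mul_const]
  exact hg.comp (measurable_id.sub_const y)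

lemma locallyIntegrable_of_convolutionExists_green {k : E d → ℝ}
    (hk : ConvolutionExists (green d 1) k (ContinuousLinearMap.lsmul ℝ ℝ) volume) :
    LocallyIntegrable k := by
  obtain ⟨δ, hδ, hcenter⟩ := exists_half_green_one_zero_lt d
  intro x₀
  have hpos : ∀ y ∈ Metric.ball x₀ δ, green d 1 (x₀ - y) ≠ 0 := fun y hy =>
    ((half_pos (green_zero_pos one_pos)).trans
      (hcenter _ (by rwa [← dist_eq_norm, dist_comm]))).ne'
  have hinv : ContinuousOn (fun y => (green d 1 (x₀ - y))⁻¹) (Metric.ball x₀ δ) :=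
    ((continuous_green one_pos).comp (continuous_const.sub continuous_id)).continuousOn.inv₀ hpos
  have hlocal : LocallyIntegrableOn k (Metric.ball x₀ δ) := by
    refine ((hk x₀).integrable_swap.integrableOn.locallyIntegrableOn.continuousOn_mul hinv
      Metric.isOpen_ball.isLocallyClosed).congr ?_
    filter_upwards [self_mem_ae_restrict measurableSet_ball] with y hy
    exact inv_mul_cancel_left₀ (hpos y hy) (k y)
  have := hlocal x₀ (Metric.mem_ball_self hδ)
  rwa [Metric.isOpen_ball.nhdsWithin_eq (Metric.mem_ball_self hδ)] at this

lemma exists_lintegral_mul_lintegral_ball_green_lt_top {k : E d → ℝ}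
    (hk : ConvolutionExists (green d 1) k (ContinuousLinearMap.lsmul ℝ ℝ) volume) :
    ∃ x₀, ∃ ε > 0,
      ∫⁻ y, ‖k y‖ₑ * ∫⁻ w in Metric.ball (x₀ - y) ε, ‖green d 1 w‖ₑ < ∞ := by
  have hmeas : AEMeasurable (fun y => ‖k y‖ₑ) :=
    (locallyIntegrable_of_convolutionExists_green hk).aestronglyMeasurable.enorm
  have hgreen : Continuous fun x : E d => ‖green d 1 x‖ₑ := (continuous_green one_pos).enorm
  have hlsc : LowerSemicontinuous fun x => ∫⁻ y, ‖green d 1 (x - y)‖ₑ * ‖k y‖ₑ :=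
    lowerSemicontinuous_lintegral
      (fun x => (hgreen.comp (continuous_sub_left x)).measurable.aemeasurable.mul hmeas)
      fun y => ((ENNReal.continuous_mul_const enorm_ne_top).comp
        (hgreen.comp (continuous_sub_right y))).lowerSemicontinuous
  have hfin : ∀ x, ∫⁻ y, ‖green d 1 (x - y)‖ₑ * ‖k y‖ₑ ≠ ∞ := fun x => by
    have h := (hk x).integrable_swap.hasFiniteIntegral
    simp only [HasFiniteIntegral, ContinuousLinearMap.lsmul_apply, smul_eq_mul, enorm_mul] at h
    exact h.ne
  obtain ⟨x₀, ε, hε, n, hn⟩ := exists_forall_mem_ball_le_natCast hlsc hfin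
  refine ⟨x₀, ε, hε, ?_⟩
  rw [lintegral_mul_lintegral_ball_sub hgreen.measurable hmeas]
  calc ∫⁻ x in Metric.ball x₀ ε, ∫⁻ y, ‖green d 1 (x - y)‖ₑ * ‖k y‖ₑ
      ≤ ∫⁻ _ in Metric.ball x₀ ε, (n : ℝ≥0∞) := setLIntegral_mono measurable_const hn
    _ = n * volume (Metric.ball x₀ ε) := setLIntegral_const _ _
    _ < ∞ := ENNReal.mul_lt_top (ENNReal.natCast_lt_top n) measure_ball_lt_top

lemma exists_enorm_weight_le_lintegral_ball_green (hd : 1 ≤ d) : ∃ K, 0 < K ∧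
    ∀ (x₀ : E d) (ε : ℝ), 0 < ε → ∃ A : ℝ, ∀ y ∈ (Metric.ball x₀ 1)ᶜ,
      ‖weight K y‖ₑ ≤ ENNReal.ofReal A * ∫⁻ w in Metric.ball (x₀ - y) ε, ‖green d 1 w‖ₑ := by
  obtain ⟨K, hK, hlower⟩ := exists_le_lintegral_green_one hd
  refine ⟨2 * K, by positivity, fun x₀ ε hε => ?_⟩
  obtain ⟨c, hc, hlower⟩ := hlower ε hε
  have hA : 0 ≤ (weight (2 * K) x₀)⁻¹ * c⁻¹ :=
    mul_nonneg (inv_nonneg.2 (weight_pos _ _).le) (inv_nonneg.2 hc.le)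
  refine ⟨(weight (2 * K) x₀)⁻¹ * c⁻¹, fun y hy => ?_⟩
  have hfar : 1 ≤ ‖x₀ - y‖ := by simpa [dist_eq_norm, norm_sub_rev] using hy
  have hweight : weight (2 * K) y ≤
      (weight (2 * K) x₀)⁻¹ * c⁻¹ * (c * weight K (x₀ - y)) := by
    have h := weight_sub_le (mul_pos two_pos hK).le x₀ (x₀ - y)
    rw [sub_sub_cancel, mul_div_cancel_left₀ K two_ne_zero] at h
    rwa [mul_assoc, inv_mul_cancel_left₀ hc.ne']
  calc ‖weight (2 * K) y‖ₑ = ENNReal.ofReal (weight (2 * K) y) :=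
        Real.enorm_of_nonneg (weight_pos _ _).le
    _ ≤ ENNReal.ofReal ((weight (2 * K) x₀)⁻¹ * c⁻¹) *
          ENNReal.ofReal (c * weight K (x₀ - y)) := by
        rw [← ENNReal.ofReal_mul hA]
        exact ENNReal.ofReal_le_ofReal hweight
    _ ≤ _ := by gcongr; exact hlower _ hfar

lemma exists_integrable_weight_mul (hd : 1 ≤ d) : ∃ K, 0 < K ∧ ∀ k : E d → ℝ,
    ConvolutionExists (green d 1) k (ContinuousLinearMap.lsmul ℝ ℝ) volume →
      Integrable fun y => weight K y * k y := by
  obtain ⟨K, hK, hweight⟩ := exists_enorm_weight_le_lintegral_ball_green hd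
  refine ⟨K, hK, fun k hk => ?_⟩
  have hloc := locallyIntegrable_of_convolutionExists_green hk
  obtain ⟨x₀, ε, hε, hfin⟩ := exists_lintegral_mul_lintegral_ball_green_lt_top hk
  obtain ⟨A, hA⟩ := hweight x₀ ε hε
  have hinside : IntegrableOn (fun y => weight K y * k y) (Metric.ball x₀ 1) :=
    ((hloc.integrableOn_isCompact (isCompact_closedBall x₀ 1)).continuousOn_mul
      (continuous_weight _).continuousOn (isCompact_closedBall x₀ 1)).mono_set
      Metric.ball_subset_closedBall
  have houtside : IntegrableOn (fun y => weight K y * k y) (Metric.ball x₀ 1)ᶜ := by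
    refine ⟨((continuous_weight _).aestronglyMeasurable.mul hloc.aestronglyMeasurable).restrict, ?_⟩
    calc ∫⁻ y in (Metric.ball x₀ 1)ᶜ, ‖weight K y * k y‖ₑ
        ≤ ∫⁻ y in (Metric.ball x₀ 1)ᶜ, ENNReal.ofReal A *
            (‖k y‖ₑ * ∫⁻ w in Metric.ball (x₀ - y) ε, ‖green d 1 w‖ₑ) :=
          setLIntegral_mono' measurableSet_ball.compl fun y hy => by
            rw [enorm_mul, mul_comm, mul_left_comm]
            gcongr
            exact hA y hy
      _ ≤ ∫⁻ y, ENNReal.ofReal A *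
            (‖k y‖ₑ * ∫⁻ w in Metric.ball (x₀ - y) ε, ‖green d 1 w‖ₑ) :=
          setLIntegral_le_lintegral _ _
      _ < ∞ := by
          rw [lintegral_const_mul' _ _ ENNReal.ofReal_ne_top]
          exact ENNReal.mul_lt_top ENNReal.ofReal_lt_top hfin
  simpa only [union_compl_self, integrableOn_univ] using hinside.union houtside

lemma convolutionExists_green_one_comp_smul {k : E d → ℝ} {l : ℝ} (hl : 0 < l)
    (hk : ConvolutionExists (green d (l ^ 4)) k (ContinuousLinearMap.lsmul ℝ ℝ) volume) :
    ConvolutionExists (green d 1) (fun y => k (l • y)) (ContinuousLinearMap.lsmul ℝ ℝ) volume := by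
  intro x
  have h := ((integrable_comp_smul_iff volume _ hl.ne').2 (hk (l • x)).integrable_swap).const_mul
    (l ^ d)
  refine convolutionExistsAt_iff_integrable_swap.2 (h.congr (.of_forall fun y => ?_))
  simp only [ContinuousLinearMap.lsmul_apply, smul_eq_mul]
  rw [← smul_sub, green_pow_four hl, inv_smul_smul₀ hl.ne', mul_assoc,
    mul_inv_cancel_left₀ (pow_ne_zero d hl.ne')]

/-- Integrability against every weight `exp (-c |y|^{4/3})`; this turns out to be equivalent to the
existence of the bi-caloric extension. -/
def WeightIntegrable (k : E d → ℝ) : Prop :=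
  ∀ c : ℝ, 0 < c → Integrable fun y => weight c y * k y

lemma HasExtension.weightIntegrable (hd : 1 ≤ d) {k : E d → ℝ} (hk : HasExtension k) :
    WeightIntegrable k := by
  intro c hc
  obtain ⟨K, hK, hint⟩ := exists_integrable_weight_mul hd
  obtain ⟨l, hl, hlK⟩ : ∃ l : ℝ, 0 < l ∧ c * l ^ (4 / 3 : ℝ) = K := by
    refine ⟨(K / c) ^ (3 / 4 : ℝ), by positivity, ?_⟩
    rw [← Real.rpow_mul (by positivity)]
    norm_num
    field_simp
  refine (integrable_comp_smul_iff volume _ hl.ne').1 ?_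
  simp only [weight_smul c hl.le, hlK]
  exact hint _ (convolutionExists_green_one_comp_smul hl (hk _ (by positivity)))

lemma WeightIntegrable.aestronglyMeasurable {k : E d → ℝ} (hk : WeightIntegrable k) :
    AEStronglyMeasurable k := by
  have h := ((continuous_weight 1).inv₀ fun y => (weight_pos 1 y).ne').aestronglyMeasurable.mul
    (hk 1 one_pos).aestronglyMeasurable
  exact h.congr (.of_forall fun y => inv_mul_cancel_left₀ (weight_pos 1 y).ne' (k y))

end WeightIntegrable

section Regularity

variable {d : ℕ}

lemma rpow_quarter_pow_four {t : ℝ} (ht : 0 ≤ t) : (t ^ (1 / 4 : ℝ)) ^ 4 = t := by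
  rw [← Real.rpow_mul_natCast ht]
  norm_num

lemma exists_abs_green_le_and_norm_fderiv_green_le (d : ℕ) {a b : ℝ} (ha : 0 < a) (hb : 0 < b) :
    ∃ C c : ℝ, 0 < C ∧ 0 < c ∧ ∀ t ∈ Icc a b, ∀ x : E d,
      |green d t x| ≤ C * weight c x ∧ ‖fderiv ℝ (green d t) x‖ ≤ C * weight c x := by
  obtain ⟨C, c, hC, hc, hone⟩ := exists_abs_green_one_le_and_norm_fderiv_green_one_le d
  set α := a ^ (1 / 4 : ℝ)
  set β := b ^ (1 / 4 : ℝ)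
  have hα : 0 < α := Real.rpow_pos_of_pos ha _
  have hβ : 0 < β := Real.rpow_pos_of_pos hb _
  refine ⟨C * max (α ^ d)⁻¹ (α ^ (d + 1))⁻¹, c * β⁻¹ ^ (4 / 3 : ℝ), by positivity,
    mul_pos hc (Real.rpow_pos_of_pos (inv_pos.2 hβ) _), fun t ht x => ?_⟩
  have ht_pos : 0 < t := ha.trans_le ht.1
  set l := t ^ (1 / 4 : ℝ)
  have hl : 0 < l := Real.rpow_pos_of_pos ht_pos _
  have hαl : α ≤ l := Real.rpow_le_rpow ha.le ht.1 (by norm_num)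
  have hlβ : l ≤ β := Real.rpow_le_rpow ht_pos.le ht.2 (by norm_num)
  have hweight : weight c (l⁻¹ • x) ≤ weight (c * β⁻¹ ^ (4 / 3 : ℝ)) x := by
    rw [weight_smul c (inv_nonneg.2 hl.le)]
    exact weight_anti (by gcongr) x
  have hbound_nonneg : 0 ≤ C * weight c (l⁻¹ • x) := mul_nonneg hC.le (weight_pos _ _).le
  have hscale : ∀ n, (α ^ n)⁻¹ ≤ max (α ^ d)⁻¹ (α ^ (d + 1))⁻¹ → ∀ u, u ≤ C * weight c (l⁻¹ • x) →
      (l ^ n)⁻¹ * u ≤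
        C * max (α ^ d)⁻¹ (α ^ (d + 1))⁻¹ * weight (c * β⁻¹ ^ (4 / 3 : ℝ)) x := by
    intro n hn u hu
    have hln : (l ^ n)⁻¹ ≤ max (α ^ d)⁻¹ (α ^ (d + 1))⁻¹ :=
      (inv_anti₀ (pow_pos hα n) (by gcongr)).trans hn
    calc (l ^ n)⁻¹ * u ≤ (l ^ n)⁻¹ * (C * weight c (l⁻¹ • x)) := by gcongr
      _ ≤ max (α ^ d)⁻¹ (α ^ (d + 1))⁻¹ * (C * weight (c * β⁻¹ ^ (4 / 3 : ℝ)) x) := by gcongr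
      _ = _ := by ring
  rw [← rpow_quarter_pow_four ht_pos.le, green_pow_four hl, fderiv_green_pow_four hl, abs_mul,
    norm_smul, abs_of_pos (by positivity), Real.norm_of_nonneg (by positivity)]
  exact ⟨hscale d (le_max_left _ _) _ (hone _).1, hscale (d + 1) (le_max_right _ _) _ (hone _).2⟩

lemma WeightIntegrable.integrable_green {k : E d → ℝ} (hk : WeightIntegrable k) {t : ℝ}
    (ht : 0 < t) (x : E d) : Integrable fun y => green d t (x - y) * k y := by
  obtain ⟨C, c, hC, hc, hgreen⟩ := exists_abs_green_le_and_norm_fderiv_green_le d ht ht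
  refine ((hk (c / 2) (half_pos hc)).norm.const_mul (C * (weight c x)⁻¹)).mono'
    (((continuous_green ht).comp (continuous_sub_left x)).aestronglyMeasurable.mul
      hk.aestronglyMeasurable) (.of_forall fun y => ?_)
  calc ‖green d t (x - y) * k y‖ ≤ C * weight c (x - y) * ‖k y‖ := by
        rw [norm_mul]
        gcongr
        exact (hgreen t ⟨le_rfl, le_rfl⟩ _).1
    _ ≤ C * ((weight c x)⁻¹ * weight (c / 2) y) * ‖k y‖ := by
        gcongr
        exact weight_sub_le hc.le x y
    _ = C * (weight c x)⁻¹ * ‖weight (c / 2) y * k y‖ := by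
        rw [norm_mul, Real.norm_of_nonneg (weight_pos _ _).le]
        ring

lemma WeightIntegrable.hasExtension {k : E d → ℝ} (hk : WeightIntegrable k) : HasExtension k :=
  fun _ ht x => convolutionExistsAt_iff_integrable_swap.2 (hk.integrable_green ht x)

lemma extension_apply (k : E d → ℝ) (t : ℝ) (x : E d) :
    extension k t x = ∫ y, green d t (x - y) * k y := by
  simp only [extension, convolution_eq_swap, ContinuousLinearMap.lsmul_apply, smul_eq_mul]

lemma WeightIntegrable.exists_eventually_norm_smul_fderiv_green_le {k : E d → ℝ}
    (hk : WeightIntegrable k) {t : ℝ} (ht : 0 < t) (x : E d) :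
    ∃ B : E d → ℝ, Integrable B ∧ ∀ᶠ p : ℝ × E d in nhds (t, x), ∀ y,
      ‖k y • fderiv ℝ (green d p.1) (p.2 - y)‖ ≤ B y := by
  obtain ⟨C, c, hC, hc, hgreen⟩ :=
    exists_abs_green_le_and_norm_fderiv_green_le d (half_pos ht) (mul_pos two_pos ht)
  set A := (weight c x)⁻¹ + 1
  refine ⟨_, (hk (c / 2) (half_pos hc)).norm.const_mul (C * A), ?_⟩
  have htime : ∀ᶠ p : ℝ × E d in nhds (t, x), p.1 ∈ Icc (t / 2) (2 * t) :=
    continuousAt_fst.eventually (Icc_mem_nhds (half_lt_self ht) (by dsimp only; linarith))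
  have hspace : ∀ᶠ p : ℝ × E d in nhds (t, x), (weight c p.2)⁻¹ < A :=
    (((continuous_weight c).inv₀ fun y => (weight_pos c y).ne').continuousAt.comp
      (f := Prod.snd) (x := (t, x)) continuousAt_snd).eventually (gt_mem_nhds (lt_add_one _))
  filter_upwards [htime, hspace] with p hp hpA y
  calc ‖k y • fderiv ℝ (green d p.1) (p.2 - y)‖ ≤ ‖k y‖ * (C * weight c (p.2 - y)) := by
        rw [norm_smul]
        gcongr
        exact (hgreen p.1 hp _).2
    _ ≤ ‖k y‖ * (C * (A * weight (c / 2) y)) := by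
        gcongr
        exact (weight_sub_le hc.le p.2 y).trans
          (mul_le_mul_of_nonneg_right hpA.le (weight_pos _ _).le)
    _ = C * A * ‖weight (c / 2) y * k y‖ := by
        rw [norm_mul, Real.norm_of_nonneg (weight_pos _ _).le]
        ring

lemma WeightIntegrable.aestronglyMeasurable_smul_fderiv_green {k : E d → ℝ}
    (hk : WeightIntegrable k) {t : ℝ} (ht : 0 < t) (x : E d) :
    AEStronglyMeasurable fun y => k y • fderiv ℝ (green d t) (x - y) :=
  hk.aestronglyMeasurable.smul
    ((continuous_fderiv_green ht).comp (continuous_sub_left x)).aestronglyMeasurable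

lemma WeightIntegrable.hasFDerivAt_extension {k : E d → ℝ} (hk : WeightIntegrable k) {t : ℝ}
    (ht : 0 < t) (x : E d) :
    HasFDerivAt (extension k t) (∫ y, k y • fderiv ℝ (green d t) (x - y)) x := by
  obtain ⟨B, hB, hbound⟩ := hk.exists_eventually_norm_smul_fderiv_green_le ht x
  rw [funext (extension_apply k t)]
  refine hasFDerivAt_integral_of_dominated_of_fderiv_le
    ((Continuous.prodMk_right t).continuousAt.eventually hbound)
    (.of_forall fun z => (hk.integrable_green ht z).aestronglyMeasurable)
    (hk.integrable_green ht x) (hk.aestronglyMeasurable_smul_fderiv_green ht x)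
    (.of_forall fun y z hz => hz y) hB (.of_forall fun y z _ => ?_)
  have hderiv : HasFDerivAt (fun z => green d t (z - y)) (fderiv ℝ (green d t) (z - y)) z :=
    (hasFDerivAt_comp_sub y).2 (differentiable_green ht _).hasFDerivAt
  exact hderiv.mul_const (k y)

lemma WeightIntegrable.fderiv_extension {k : E d → ℝ} (hk : WeightIntegrable k) {t : ℝ}
    (ht : 0 < t) (x : E d) :
    fderiv ℝ (extension k t) x = ∫ y, k y • fderiv ℝ (green d t) (x - y) :=
  (hk.hasFDerivAt_extension ht x).fderiv

lemma continuousOn_fderiv_green :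
    ContinuousOn (fun p : ℝ × E d => fderiv ℝ (green d p.1) p.2) (Ioi 0 ×ˢ univ) := by
  have hroot : ContinuousOn (fun p : ℝ × E d => p.1 ^ (1 / 4 : ℝ)) (Ioi 0 ×ˢ univ) :=
    continuousOn_fst.rpow_const fun p hp => .inl hp.1.ne'
  have hroot_pos : ∀ p ∈ (Ioi 0 ×ˢ univ : Set (ℝ × E d)), 0 < p.1 ^ (1 / 4 : ℝ) := fun p hp =>
    Real.rpow_pos_of_pos hp.1 _
  have hscaled := ((hroot.pow (d + 1)).inv₀ fun p hp => (pow_pos (hroot_pos p hp) _).ne').smul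
    ((continuous_fderiv_green (d := d) one_pos).comp_continuousOn
      ((hroot.inv₀ fun p hp => (hroot_pos p hp).ne').smul continuousOn_snd))
  refine hscaled.congr fun p hp => ?_
  nth_rw 1 [← rpow_quarter_pow_four hp.1.le]
  exact fderiv_green_pow_four (hroot_pos p hp) p.2

lemma WeightIntegrable.continuousOn_fderiv_extension {k : E d → ℝ} (hk : WeightIntegrable k) :
    ContinuousOn (fun p : ℝ × E d => fderiv ℝ (extension k p.1) p.2) (Ioi 0 ×ˢ univ) := by
  have hopen : IsOpen (Ioi 0 ×ˢ univ : Set (ℝ × E d)) := isOpen_Ioi.prod isOpen_univ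
  suffices ContinuousOn (fun p : ℝ × E d => ∫ y, k y • fderiv ℝ (green d p.1) (p.2 - y))
      (Ioi 0 ×ˢ univ) from this.congr fun p hp => hk.fderiv_extension hp.1 p.2
  rintro ⟨t, x⟩ ⟨ht : 0 < t, -⟩
  obtain ⟨B, hB, hbound⟩ := hk.exists_eventually_norm_smul_fderiv_green_le ht x
  refine (continuousAt_of_dominated (bound := B) ?_ (hbound.mono fun p hp => .of_forall hp) hB
    (.of_forall fun y => ?_)).continuousWithinAt
  · filter_upwards [continuousAt_fst.eventually (lt_mem_nhds ht)] with p hp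
    exact hk.aestronglyMeasurable_smul_fderiv_green hp p.2
  · have hkernel : ContinuousAt (fun p : ℝ × E d => fderiv ℝ (green d p.1) p.2) (t, x - y) :=
      continuousOn_fderiv_green.continuousAt (hopen.mem_nhds ⟨ht, mem_univ _⟩)
    exact (hkernel.comp (f := fun p : ℝ × E d => (p.1, p.2 - y)) (x := (t, x))
      (by fun_prop)).const_smul (k y)

lemma exists_weight_le_pow {V : Type*} [NormedAddCommGroup V] {c : ℝ} (hc : 0 < c) (n : ℕ) :
    ∃ C : ℝ, 0 < C ∧ ∀ x : V, weight c x ≤ C * ((1 + ‖x‖) ^ n)⁻¹ := by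
  refine ⟨Real.exp (2 * c) * n.factorial * (c ^ n)⁻¹, by positivity, fun x => ?_⟩
  have hnorm : ‖x‖ ≤ 1 + ‖x‖ ^ (4 / 3 : ℝ) := by
    rcases le_total ‖x‖ 1 with h | h
    · exact h.trans (le_add_of_nonneg_right (by positivity))
    · exact (Real.self_le_rpow_of_one_le h (by norm_num)).trans (le_add_of_nonneg_left zero_le_one)
  have hexp : ((1 + ‖x‖) * c) ^ n / n.factorial ≤ Real.exp ((1 + ‖x‖) * c) :=
    Real.pow_div_factorial_le_exp _ (by positivity) n
  calc weight c x ≤ Real.exp (2 * c) * (Real.exp ((1 + ‖x‖) * c))⁻¹ := by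
        rw [weight, ← Real.exp_neg, ← Real.exp_add, Real.exp_le_exp]
        nlinarith
    _ ≤ Real.exp (2 * c) * (((1 + ‖x‖) * c) ^ n / n.factorial)⁻¹ := by gcongr
    _ = Real.exp (2 * c) * n.factorial * (c ^ n)⁻¹ * ((1 + ‖x‖) ^ n)⁻¹ := by
        rw [mul_pow]
        field_simp

lemma integrable_inv_one_add_norm_pow :
    Integrable fun x : E d => ((1 + ‖x‖) ^ (d + 1))⁻¹ := by
  have h := integrable_one_add_norm (E := E d) (μ := volume) (r := (d + 1 : ℕ))
    (by simp)
  refine h.congr (.of_forall fun x => ?_)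
  dsimp only
  rw [Real.rpow_neg (by positivity), Real.rpow_natCast]

lemma integrable_weight {c : ℝ} (hc : 0 < c) : Integrable (weight c : E d → ℝ) := by
  obtain ⟨C, -, h⟩ := exists_weight_le_pow (V := E d) hc (d + 1)
  refine (integrable_inv_one_add_norm_pow.const_mul C).mono'
    (continuous_weight c).aestronglyMeasurable (.of_forall fun x => ?_)
  rw [Real.norm_of_nonneg (weight_pos c x).le]
  exact h x

lemma weight_mul_weight_sub_sub_le {V : Type*} [NormedAddCommGroup V] {c : ℝ} (hc : 0 ≤ c)
    (x y z : V) : weight c z * weight c (x - y - z) ≤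
      weight (c / 2) z * ((weight (c / 4) x)⁻¹ * weight (c / 8) y) := by
  have hsplit : weight c z = weight (c / 2) z * weight (c / 2) z := by
    rw [← sq, ← weight_natCast_mul]
    ring_nf
  have hfirst : weight (c / 2) z * weight (c / 2) (x - y - z) ≤ weight (c / 4) (x - y) :=
    (weight_mul_weight_sub_le (by positivity) z (x - y)).trans_eq (by ring_nf)
  have hsecond : weight (c / 4) (x - y) ≤ (weight (c / 4) x)⁻¹ * weight (c / 8) y :=
    (weight_sub_le (by positivity) x y).trans_eq (by ring_nf)
  calc weight c z * weight c (x - y - z)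
      ≤ weight (c / 2) z * weight (c / 2) z * weight (c / 2) (x - y - z) := by
        rw [hsplit]
        exact mul_le_mul_of_nonneg_left (weight_anti (half_le_self hc) _)
          (mul_nonneg (weight_pos _ _).le (weight_pos _ _).le)
    _ ≤ weight (c / 2) z * ((weight (c / 4) x)⁻¹ * weight (c / 8) y) := by
        rw [mul_assoc]
        exact mul_le_mul_of_nonneg_left (hfirst.trans hsecond) (weight_pos _ _).le

lemma WeightIntegrable.integrable_smul_green_smul_fderiv_green {k : E d → ℝ}
    (hk : WeightIntegrable k) {s t : ℝ} (hs : 0 < s) (ht : 0 < t) (x : E d) :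
    Integrable (Function.uncurry fun y z : E d =>
      k y • green d s z • fderiv ℝ (green d t) (x - y - z)) (volume.prod volume) := by
  obtain ⟨C, c, hC, hc, hgreen⟩ := exists_abs_green_le_and_norm_fderiv_green_le d
    (lt_min hs ht) (lt_max_of_lt_left hs (c := t))
  have hdom : Integrable (fun p : E d × E d => C * C * (weight (c / 4) x)⁻¹ *
      (‖weight (c / 8) p.1 * k p.1‖ * weight (c / 2) p.2)) (volume.prod volume) :=
    ((hk _ (by positivity)).norm.mul_prod (integrable_weight (by positivity))).const_mul _
  refine hdom.mono' (hk.aestronglyMeasurable.comp_fst.smul (Continuous.aestronglyMeasurable ?_))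
    (.of_forall fun ⟨y, z⟩ => ?_)
  · exact ((continuous_green hs).comp continuous_snd).smul ((continuous_fderiv_green ht).comp
      ((continuous_const.sub continuous_fst).sub continuous_snd))
  calc ‖k y • green d s z • fderiv ℝ (green d t) (x - y - z)‖
      ≤ ‖k y‖ * (C * weight c z * (C * weight c (x - y - z))) := by
        rw [norm_smul, norm_smul]
        gcongr
        · exact mul_nonneg hC.le (weight_pos _ _).le
        · exact (hgreen s ⟨min_le_left s t, le_max_left s t⟩ z).1
        · exact (hgreen t ⟨min_le_right s t, le_max_right s t⟩ _).2
    _ = C * C * ‖k y‖ * (weight c z * weight c (x - y - z)) := by ring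
    _ ≤ C * C * ‖k y‖ * (weight (c / 2) z * ((weight (c / 4) x)⁻¹ * weight (c / 8) y)) := by
        gcongr ?_ * ?_
        exact weight_mul_weight_sub_sub_le hc.le x y z
    _ = _ := by
        rw [norm_mul, Real.norm_of_nonneg (weight_pos _ _).le]
        ring

lemma WeightIntegrable.fderiv_extension_add {k : E d → ℝ} (hk : WeightIntegrable k) {s t : ℝ}
    (hs : 0 < s) (ht : 0 < t) (x : E d) :
    fderiv ℝ (extension k (s + t)) x =
      ∫ z, green d s z • fderiv ℝ (extension k t) (x - z) := by
  calc fderiv ℝ (extension k (s + t)) x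
      = ∫ y, ∫ z, k y • green d s z • fderiv ℝ (green d t) (x - y - z) := by
        simp_rw [hk.fderiv_extension (add_pos hs ht), fderiv_green_add hs ht, integral_smul]
    _ = ∫ z, ∫ y, k y • green d s z • fderiv ℝ (green d t) (x - y - z) :=
        integral_integral_swap (hk.integrable_smul_green_smul_fderiv_green hs ht x)
    _ = ∫ z, green d s z • fderiv ℝ (extension k t) (x - z) := by
        simp_rw [hk.fderiv_extension ht, ← integral_smul, sub_right_comm x, smul_comm (k _)]

end Regularity

section UpperBound

variable {d : ℕ}

lemma ennreal_rpow_half_le_iff {a b : ℝ≥0∞} : a ^ (1 / 2 : ℝ) ≤ b ↔ a ≤ b ^ 2 := by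
  rw [one_div, ENNReal.rpow_inv_le_iff two_pos, ENNReal.rpow_ofNat]

lemma normX0_le_iff {h : ℝ → E d → ℝ} {N : ℝ≥0∞} :
    normX0 h ≤ N ↔ ∀ x r, 0 < r → energy h x r ≤ N ^ 2 := by
  simp only [normX0, ennreal_rpow_half_le_iff, iSup_le_iff]

lemma normX0Loc_le_iff {R : ℝ} {h : ℝ → E d → ℝ} {N : ℝ≥0∞} :
    normX0Loc R h ≤ N ↔ ∀ x r, 0 < r ∧ r ≤ R → energy h x r ≤ N ^ 2 := by
  simp only [normX0Loc, ennreal_rpow_half_le_iff, iSup_le_iff]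

lemma enorm_gradient {𝕜 F : Type*} [RCLike 𝕜] [NormedAddCommGroup F] [InnerProductSpace 𝕜 F]
    [CompleteSpace F] (f : F → 𝕜) (x : F) : ‖gradient f x‖ₑ = ‖fderiv 𝕜 f x‖ₑ :=
  LinearIsometryEquiv.enorm_map _ _

lemma weightedGrad_le_iff {h : ℝ → E d → ℝ} {t : ℝ} {N : ℝ≥0∞} : weightedGrad h t ≤ N ↔
    ∀ᵐ x, ENNReal.ofReal (t ^ (1 / 4 : ℝ)) * ‖fderiv ℝ (h t) x‖ₑ ≤ N := by
  rw [weightedGrad, eLpNorm_exponent_top, eLpNormEssSup, ← ENNReal.essSup_const_mul]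
  simp only [enorm_gradient]
  exact ⟨fun hN => (ENNReal.ae_le_essSup _).mono fun x hx => hx.trans hN, essSup_le_of_ae_le N⟩

lemma lintegral_rpow_neg_half {a : ℝ} (ha : 0 < a) :
    ∫⁻ t in Ioo 0 (a ^ 4), ENNReal.ofReal (t ^ (-(1 / 2) : ℝ)) = ENNReal.ofReal (2 * a ^ 2) := by
  have hint : IntegrableOn (fun t : ℝ => t ^ (-(1 / 2) : ℝ)) (Ioo 0 (a ^ 4)) :=
    (intervalIntegral.integrableOn_Ioo_rpow_iff (by positivity)).2 (by norm_num)
  have hroot : (a ^ 4) ^ (1 / 2 : ℝ) = a ^ 2 := by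
    rw [← Real.rpow_natCast_mul ha.le, ← Real.rpow_natCast a 2]
    norm_num
  have hvalue : ∫ t in Ioo 0 (a ^ 4), t ^ (-(1 / 2) : ℝ) = 2 * a ^ 2 := by
    rw [← integral_Ioc_eq_integral_Ioo, ← intervalIntegral.integral_of_le (by positivity),
      integral_rpow (.inl (by norm_num)), show (-(1 / 2) + 1 : ℝ) = 1 / 2 by norm_num, hroot,
      Real.zero_rpow (by norm_num)]
    ring
  rw [← ofReal_integral_eq_lintegral_ofReal hint
    ((ae_restrict_mem measurableSet_Ioo).mono fun t ht => Real.rpow_nonneg ht.1.le _), hvalue]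

lemma volume_ball_eq_ofReal_pow_mul (x : E d) {r : ℝ} (hr : 0 < r) :
    volume (Metric.ball x r) = ENNReal.ofReal r ^ d * volume (Metric.ball (0 : E d) 1) := by
  rw [Measure.addHaar_ball_of_pos volume x hr, finrank_euclideanSpace_fin,
    ENNReal.ofReal_pow hr.le]

lemma ae_enorm_gradient_sq_le_of_weightedGrad_le {h : ℝ → E d → ℝ} {t : ℝ} (ht : 0 < t)
    {N : ℝ≥0∞} (hN : weightedGrad h t ≤ N) :
    ∀ᵐ y, ‖gradient (h t) y‖ₑ ^ 2 ≤ ENNReal.ofReal (t ^ (-(1 / 2) : ℝ)) * N ^ 2 := by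
  have hcancel :
      ENNReal.ofReal (t ^ (-(1 / 2) : ℝ)) * ENNReal.ofReal (t ^ (1 / 4 : ℝ)) ^ 2 = 1 := by
    rw [← ENNReal.ofReal_pow (by positivity), ← Real.rpow_mul_natCast ht.le,
      ← ENNReal.ofReal_mul (by positivity), ← Real.rpow_add ht]
    norm_num
  filter_upwards [weightedGrad_le_iff.1 hN] with y hy
  calc ‖gradient (h t) y‖ₑ ^ 2 = ENNReal.ofReal (t ^ (-(1 / 2) : ℝ)) *
        (ENNReal.ofReal (t ^ (1 / 4 : ℝ)) * ‖fderiv ℝ (h t) y‖ₑ) ^ 2 := by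
        rw [mul_pow, ← mul_assoc, hcancel, one_mul, enorm_gradient]
    _ ≤ ENNReal.ofReal (t ^ (-(1 / 2) : ℝ)) * N ^ 2 := by gcongr

lemma energy_le {h : ℝ → E d → ℝ} (x : E d) {r : ℝ} (hr : 0 < r) {N : ℝ≥0∞}
    (hN : ∀ t, 0 < t → t ≤ r ^ 4 → weightedGrad h t ≤ N) :
    energy h x r ≤ 2 * volume (Metric.ball (0 : E d) 1) * N ^ 2 := by
  have hslice : ∀ t ∈ Ioo 0 (r ^ 4), ∫⁻ y in Metric.ball x r, ‖gradient (h t) y‖ₑ ^ 2 ≤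
      ENNReal.ofReal (t ^ (-(1 / 2) : ℝ)) * (N ^ 2 * volume (Metric.ball x r)) := by
    intro t ht
    refine (lintegral_mono_ae (ae_restrict_of_ae
      (ae_enorm_gradient_sq_le_of_weightedGrad_le ht.1 (hN t ht.1 ht.2.le)))).trans_eq ?_
    rw [setLIntegral_const, mul_assoc]
  refine ENNReal.div_le_of_le_mul ?_
  calc ∫⁻ t in Ioo 0 (r ^ 4), ∫⁻ y in Metric.ball x r, ‖gradient (h t) y‖ₑ ^ 2
      ≤ ∫⁻ t in Ioo 0 (r ^ 4),
          ENNReal.ofReal (t ^ (-(1 / 2) : ℝ)) * (N ^ 2 * volume (Metric.ball x r)) :=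
        setLIntegral_mono' measurableSet_Ioo hslice
    _ = ENNReal.ofReal (2 * r ^ 2) * (N ^ 2 * volume (Metric.ball x r)) := by
        rw [lintegral_mul_const _ (by fun_prop), lintegral_rpow_neg_half hr]
    _ = 2 * volume (Metric.ball (0 : E d) 1) * N ^ 2 * ENNReal.ofReal (r ^ (d + 2)) := by
        rw [volume_ball_eq_ofReal_pow_mul x hr, ENNReal.ofReal_mul (by norm_num),
          ENNReal.ofReal_pow hr.le, ENNReal.ofReal_pow hr.le, ENNReal.ofReal_ofNat]
        ring

lemma exists_normX0_le_normX (d : ℕ) : ∃ C : ℝ≥0, 0 < C ∧ ∀ h : ℝ → E d → ℝ,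
    normX0 h ≤ C * normX h ∧ ∀ R, normX0Loc R h ≤ C * normXLoc R h := by
  obtain ⟨C, hC_pos, hC⟩ :
      ∃ C : ℝ≥0, 0 < C ∧ 2 * volume (Metric.ball (0 : E d) 1) ≤ (C : ℝ≥0∞) ^ 2 := by
    obtain ⟨n, hn⟩ := ENNReal.exists_nat_gt (ENNReal.mul_ne_top (ENNReal.ofNat_ne_top (n := 2))
      (measure_ball_lt_top (μ := volume) (x := (0 : E d)) (r := 1)).ne)
    refine ⟨n + 1, by positivity, hn.le.trans ?_⟩
    norm_cast
    nlinarith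
  have henergy : ∀ {h : ℝ → E d → ℝ} {x : E d} {r : ℝ} {N : ℝ≥0∞}, 0 < r →
      (∀ t, 0 < t → t ≤ r ^ 4 → weightedGrad h t ≤ N) → energy h x r ≤ (C * N) ^ 2 :=
    fun hr hN => (energy_le _ hr hN).trans (by rw [mul_pow]; gcongr)
  refine ⟨C, hC_pos, fun h => ⟨normX0_le_iff.2 fun x r hr => henergy hr fun t ht _ => ?_,
    fun R => normX0Loc_le_iff.2 fun x r hr => henergy hr.1 fun t ht htr => ?_⟩⟩
  · exact le_iSup₂ (f := fun t (_ : 0 < t) => weightedGrad h t) t ht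
  · exact le_iSup₂ (f := fun t (_ : 0 < t ∧ t ≤ R ^ 4) => weightedGrad h t) t
      ⟨ht, htr.trans (pow_le_pow_left₀ hr.1.le hr.2 4)⟩

end UpperBound

section PolynomialKernel

variable {d : ℕ}

/-- The approximate identity `r^{-d} (1 + |w| / r)^{-(d+1)}`, which dominates `G(t,·)` and
`t^{1/4} |∇G(t,·)|` for `t = r⁴`. -/
def polyKernel (r : ℝ) (w : E d) : ℝ := (r ^ d)⁻¹ * ((1 + ‖w‖ / r) ^ (d + 1))⁻¹

lemma continuous_polyKernel {r : ℝ} (hr : 0 < r) : Continuous (polyKernel r : E d → ℝ) :=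
  continuous_const.mul (Continuous.inv₀ (by fun_prop) fun w => by positivity)

lemma polyKernel_eq_mul_polyKernel_one {r : ℝ} (hr : 0 < r) (w : E d) :
    polyKernel r w = (r ^ d)⁻¹ * polyKernel 1 (r⁻¹ • w) := by
  simp only [polyKernel, norm_smul, Real.norm_of_nonneg (inv_nonneg.2 hr.le), one_pow, inv_one,
    one_mul, div_eq_inv_mul]

lemma polyKernel_le_of_dist_lt {r : ℝ} (hr : 0 < r) {x y z : E d} (h : dist y z < r) :
    polyKernel r (x - y) ≤ 2 ^ (d + 1) * polyKernel r (x - z) := by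
  have hnorm : ‖x - z‖ / r ≤ ‖x - y‖ / r + 1 := by
    rw [div_add_one hr.ne']
    gcongr
    simp only [← dist_eq_norm]
    exact (dist_triangle x y z).trans (by gcongr)
  have hdouble : 1 + ‖x - z‖ / r ≤ 2 * (1 + ‖x - y‖ / r) := by
    linarith [div_nonneg (norm_nonneg (x - y)) hr.le]
  calc polyKernel r (x - y)
      = 2 ^ (d + 1) * ((r ^ d)⁻¹ * ((2 * (1 + ‖x - y‖ / r)) ^ (d + 1))⁻¹) := by
        rw [polyKernel, mul_pow]
        field_simp
    _ ≤ 2 ^ (d + 1) * polyKernel r (x - z) := by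
        rw [polyKernel]
        gcongr

lemma polyKernel_le_of_le_two_mul {l r : ℝ} (hl : 0 < l) (hlr : l ≤ r) (hrl : r ≤ 2 * l)
    (w : E d) : polyKernel l w ≤ 2 ^ d * polyKernel r w := by
  have hr : 0 < r := hl.trans_le hlr
  calc polyKernel l w = 2 ^ d * (((2 * l) ^ d)⁻¹ * ((1 + ‖w‖ / l) ^ (d + 1))⁻¹) := by
        rw [polyKernel, mul_pow]
        field_simp
    _ ≤ 2 ^ d * polyKernel r w := by
        rw [polyKernel]
        gcongr

lemma exists_lintegral_polyKernel_eq (d : ℕ) : ∃ M : ℝ≥0, ∀ {r : ℝ}, 0 < r → ∀ x : E d,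
    ∫⁻ z, ENNReal.ofReal (polyKernel r (x - z)) = M := by
  have hmeas : ∀ {r : ℝ}, 0 < r → Measurable fun w : E d => ENNReal.ofReal (polyKernel r w) :=
    fun hr => (continuous_polyKernel hr).measurable.ennreal_ofReal
  have hone : Integrable (polyKernel 1 : E d → ℝ) := by
    refine integrable_inv_one_add_norm_pow.congr (.of_forall fun w => ?_)
    simp only [polyKernel, one_pow, inv_one, one_mul, div_one]
  refine ⟨(∫⁻ w : E d, ENNReal.ofReal (polyKernel 1 w)).toNNReal, fun {r} hr x => ?_⟩
  rw [ENNReal.coe_toNNReal hone.lintegral_lt_top.ne,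
    lintegral_sub_left_eq_self (fun z => ENNReal.ofReal (polyKernel r z)) x]
  simp only [polyKernel_eq_mul_polyKernel_one hr,
    ENNReal.ofReal_mul (inv_nonneg.2 (pow_pos hr d).le)]
  rw [lintegral_const_mul' _ _ ENNReal.ofReal_ne_top,
    ← lintegral_map (g := fun w : E d => r⁻¹ • w) (hmeas one_pos) (by fun_prop),
    Measure.map_addHaar_smul volume (inv_ne_zero hr.ne'), finrank_euclideanSpace_fin,
    lintegral_smul_measure, smul_eq_mul, ← mul_assoc, ← ENNReal.ofReal_mul (by positivity),
    abs_of_pos (by positivity), inv_pow, inv_inv, inv_mul_cancel₀ (by positivity),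
    ENNReal.ofReal_one, one_mul]

lemma exists_green_le_polyKernel (d : ℕ) : ∃ C : ℝ, 0 < C ∧ ∀ {l : ℝ}, 0 < l → ∀ w : E d,
    |green d (l ^ 4) w| ≤ C * polyKernel l w ∧
      l * ‖fderiv ℝ (green d (l ^ 4)) w‖ ≤ C * polyKernel l w := by
  obtain ⟨C₀, c, hC₀, hc, hgreen⟩ := exists_abs_green_one_le_and_norm_fderiv_green_one_le d
  obtain ⟨C₁, hC₁, hweight⟩ := exists_weight_le_pow (V := E d) hc (d + 1)
  have hone : ∀ w : E d, C₀ * weight c w ≤ C₀ * C₁ * polyKernel 1 w := fun w => by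
    simpa only [polyKernel, one_pow, inv_one, one_mul, div_one, mul_assoc] using
      mul_le_mul_of_nonneg_left (hweight w) hC₀.le
  refine ⟨C₀ * C₁, by positivity, fun {l} hl w => ?_⟩
  have hscale : ∀ u ≤ C₀ * weight c (l⁻¹ • w), (l ^ d)⁻¹ * u ≤ C₀ * C₁ * polyKernel l w := by
    intro u hu
    rw [polyKernel_eq_mul_polyKernel_one hl, mul_left_comm]
    gcongr
    exact hu.trans (hone _)
  constructor
  · rw [green_pow_four hl, abs_mul, abs_of_pos (by positivity)]
    exact hscale _ (hgreen _).1
  · rw [fderiv_green_pow_four hl, norm_smul, Real.norm_of_nonneg (by positivity), ← mul_assoc,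
      pow_succ, mul_inv, mul_left_comm, mul_inv_cancel₀ hl.ne', mul_one]
    exact hscale _ (hgreen _).2

lemma exists_abs_green_le_polyKernel_of_mem_Icc (d : ℕ) : ∃ C : ℝ, 0 < C ∧ ∀ {r : ℝ}, 0 < r →
    ∀ t ∈ Icc (r ^ 4 / 2) (r ^ 4), ∀ w : E d, |green d t w| ≤ C * polyKernel r w := by
  obtain ⟨C, hC, hgreen⟩ := exists_green_le_polyKernel d
  refine ⟨C * 2 ^ d, by positivity, fun {r} hr t ht w => ?_⟩
  have ht_pos : 0 < t := lt_of_lt_of_le (by positivity) ht.1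
  set l := t ^ (1 / 4 : ℝ)
  have hl : 0 < l := Real.rpow_pos_of_pos ht_pos _
  have hl4 : l ^ 4 = t := rpow_quarter_pow_four ht_pos.le
  have hlr : l ≤ r := le_of_pow_le_pow_left₀ four_ne_zero hr.le (hl4.trans_le ht.2)
  have hrl : r ≤ 2 * l := by
    refine le_of_pow_le_pow_left₀ four_ne_zero (by positivity) ?_
    rw [mul_pow, hl4]
    linarith [ht.1]
  rw [← hl4, mul_assoc]
  exact (hgreen hl w).1.trans (by gcongr; exact polyKernel_le_of_le_two_mul hl hlr hrl w)

end PolynomialKernel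

section CylinderAverages

variable {d : ℕ}

lemma lintegral_mul_lintegral_ball_comm {X : Type*} [PseudoMetricSpace X]
    [SecondCountableTopology X] [MeasurableSpace X] [OpensMeasurableSpace X] {μ : Measure X}
    [SFinite μ] {f g : X → ℝ≥0∞} (hf : AEMeasurable f μ) (hg : AEMeasurable g μ) (r : ℝ) :
    ∫⁻ y, f y * ∫⁻ z in Metric.ball y r, g z ∂μ ∂μ =
      ∫⁻ z, g z * ∫⁻ y in Metric.ball z r, f y ∂μ ∂μ := by
  have hset : MeasurableSet {p : X × X | dist p.1 p.2 < r} :=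
    (isOpen_lt continuous_dist continuous_const).measurableSet
  have hfg : AEMeasurable (fun p : X × X => f p.1 * g p.2) (μ.prod μ) :=
    hf.comp_fst.mul hg.comp_snd
  have hleft : ∀ y, f y * ∫⁻ z in Metric.ball y r, g z ∂μ = ∫⁻ z,
      {p : X × X | dist p.1 p.2 < r}.indicator (fun p => f p.1 * g p.2) (y, z) ∂μ := by
    intro y
    rw [← lintegral_indicator measurableSet_ball,
      ← lintegral_const_mul'' _ (hg.indicator measurableSet_ball)]
    refine lintegral_congr fun z => ?_
    by_cases hz : dist y z < r <;> simp [hz, dist_comm z y]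
  have hright : ∀ z, g z * ∫⁻ y in Metric.ball z r, f y ∂μ = ∫⁻ y,
      {p : X × X | dist p.1 p.2 < r}.indicator (fun p => f p.1 * g p.2) (y, z) ∂μ := by
    intro z
    rw [← lintegral_indicator measurableSet_ball,
      ← lintegral_const_mul'' _ (hf.indicator measurableSet_ball)]
    refine lintegral_congr fun y => ?_
    by_cases hy : dist y z < r <;> simp [hy, mul_comm]
  simp only [hleft, hright]
  exact lintegral_lintegral_swap (hfg.indicator hset)

lemma exists_lintegral_polyKernel_mul_le (d : ℕ) : ∃ C : ℝ≥0, ∀ {r : ℝ}, 0 < r → ∀ (x : E d)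
    {f : E d → ℝ≥0∞}, AEMeasurable f → ∀ {S : ℝ≥0∞}, (∀ z, ∫⁻ y in Metric.ball z r, f y ≤ S) →
      ENNReal.ofReal r ^ d * ∫⁻ y, ENNReal.ofReal (polyKernel r (x - y)) * f y ≤ C * S := by
  obtain ⟨M, hM⟩ := exists_lintegral_polyKernel_eq d
  set ω := volume (Metric.ball (0 : E d) 1)
  have hω : ω ≠ 0 := (Metric.measure_ball_pos _ _ one_pos).ne'
  have hω' : ω ≠ ∞ := measure_ball_lt_top.ne
  refine ⟨2 ^ (d + 1) * M * ω.toNNReal⁻¹, fun {r} hr x {f} hf {S} hS => ?_⟩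
  set P : E d → ℝ≥0∞ := fun y => ENNReal.ofReal (polyKernel r (x - y))
  have hP : Measurable P :=
    ((continuous_polyKernel hr).comp (continuous_sub_left x)).measurable.ennreal_ofReal
  have hsmear : ∀ y, ENNReal.ofReal r ^ d * ω * P y ≤
      2 ^ (d + 1) * ∫⁻ z in Metric.ball y r, P z := by
    intro y
    rw [← volume_ball_eq_ofReal_pow_mul y hr, mul_comm, ← setLIntegral_const,
      ← lintegral_const_mul _ hP]
    refine setLIntegral_mono' measurableSet_ball fun z hz => ?_
    rw [Metric.mem_ball'] at hz
    refine (ENNReal.ofReal_le_ofReal (polyKernel_le_of_dist_lt hr hz)).trans_eq ?_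
    rw [ENNReal.ofReal_mul (by positivity), ENNReal.ofReal_pow two_pos.le, ENNReal.ofReal_ofNat]
  have hmain : ω * (ENNReal.ofReal r ^ d * ∫⁻ y, P y * f y) ≤ 2 ^ (d + 1) * (M * S) := by
    calc ω * (ENNReal.ofReal r ^ d * ∫⁻ y, P y * f y)
        = ∫⁻ y, ENNReal.ofReal r ^ d * ω * P y * f y := by
          simp only [mul_assoc]
          rw [lintegral_const_mul' _ _ (by finiteness), lintegral_const_mul' _ _ hω']
          ring
      _ ≤ ∫⁻ y, 2 ^ (d + 1) * (f y * ∫⁻ z in Metric.ball y r, P z) :=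
          lintegral_mono fun y => (mul_le_mul_left (hsmear y) _).trans_eq (by ring)
      _ = 2 ^ (d + 1) * ∫⁻ z, P z * ∫⁻ y in Metric.ball z r, f y := by
          rw [lintegral_const_mul' _ _ (by finiteness),
            lintegral_mul_lintegral_ball_comm hf hP.aemeasurable]
      _ ≤ 2 ^ (d + 1) * ∫⁻ z, P z * S := by
          gcongr with z
          exact hS z
      _ = 2 ^ (d + 1) * (M * S) := by rw [lintegral_mul_const _ hP, hM hr]
  rw [ENNReal.coe_mul, ENNReal.coe_inv (ENNReal.toNNReal_ne_zero.2 ⟨hω, hω'⟩),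
    ENNReal.coe_toNNReal hω', mul_right_comm, ← div_eq_mul_inv]
  refine ENNReal.le_div_iff_mul_le (.inl hω) (.inl hω') |>.2 ?_
  rw [mul_comm, ENNReal.coe_mul, ENNReal.coe_pow, ENNReal.coe_ofNat, mul_assoc (2 ^ (d + 1))]
  exact hmain

lemma ennreal_le_rpow_half_iff {a b : ℝ≥0∞} : a ≤ b ^ (1 / 2 : ℝ) ↔ a ^ 2 ≤ b := by
  rw [one_div, ENNReal.le_rpow_inv_iff two_pos, ENNReal.rpow_ofNat]

lemma sq_lintegral_le {α : Type*} [MeasurableSpace α] {μ : Measure α} {f : α → ℝ≥0∞}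
    (hf : AEMeasurable f μ) : (∫⁻ a, f a ∂μ) ^ 2 ≤ (∫⁻ a, f a ^ 2 ∂μ) * μ univ := by
  have hholder := ENNReal.lintegral_mul_le_Lp_mul_Lq μ Real.HolderConjugate.two_two hf
    (aemeasurable_const (b := (1 : ℝ≥0∞)))
  simp only [Pi.mul_apply, mul_one, ENNReal.rpow_ofNat, one_pow, lintegral_one,
    ← ENNReal.mul_rpow_of_nonneg _ _ (one_half_pos (α := ℝ)).le] at hholder
  exact ennreal_le_rpow_half_iff.1 hholder

lemma setLIntegral_cylinder_le {φ : ℝ → E d → ℝ≥0∞} {r : ℝ} (hr : 0 < r)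
    (hφ : AEMeasurable (Function.uncurry φ) ((volume.restrict (Ioo 0 (r ^ 4))).prod volume))
    {z : E d} {N : ℝ≥0∞} (hN : ∫⁻ s in Ioo 0 (r ^ 4), ∫⁻ y in Metric.ball z r, φ s y ^ 2 ≤
      N ^ 2 * ENNReal.ofReal r ^ (d + 2)) :
    ∫⁻ y in Metric.ball z r, ∫⁻ s in Ioo 0 (r ^ 4), φ s y ≤
      N * (ENNReal.ofReal r ^ (d + 3) * volume (Metric.ball (0 : E d) 1) ^ (1 / 2 : ℝ)) := by
  set ω := volume (Metric.ball (0 : E d) 1)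
  have hω : (ω ^ (1 / 2 : ℝ)) ^ 2 = ω := by
    rw [← ENNReal.rpow_mul_natCast]
    norm_num
  have hφ' : AEMeasurable (Function.uncurry φ)
      ((volume.restrict (Ioo 0 (r ^ 4))).prod (volume.restrict (Metric.ball z r))) :=
    hφ.mono_measure (Measure.prod_mono le_rfl Measure.restrict_le_self)
  rw [← ENNReal.pow_le_pow_left_iff two_ne_zero]
  calc (∫⁻ y in Metric.ball z r, ∫⁻ s in Ioo 0 (r ^ 4), φ s y) ^ 2
      = (∫⁻ p, Function.uncurry φ p
          ∂((volume.restrict (Ioo 0 (r ^ 4))).prod (volume.restrict (Metric.ball z r)))) ^ 2 := by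
        rw [lintegral_prod_symm _ hφ']
        rfl
    _ ≤ (∫⁻ s in Ioo 0 (r ^ 4), ∫⁻ y in Metric.ball z r, φ s y ^ 2) *
          (ENNReal.ofReal r ^ 4 * (ENNReal.ofReal r ^ d * ω)) := by
        refine (sq_lintegral_le hφ').trans_eq ?_
        rw [lintegral_prod _ (hφ'.pow_const 2), ← univ_prod_univ, Measure.prod_prod,
          Measure.restrict_apply_univ, Measure.restrict_apply_univ, Real.volume_Ioo, sub_zero,
          volume_ball_eq_ofReal_pow_mul z hr, ENNReal.ofReal_pow hr.le]
        rfl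
    _ ≤ N ^ 2 * ENNReal.ofReal r ^ (d + 2) *
          (ENNReal.ofReal r ^ 4 * (ENNReal.ofReal r ^ d * ω)) := by gcongr
    _ = (N * (ENNReal.ofReal r ^ (d + 3) * ω ^ (1 / 2 : ℝ))) ^ 2 := by
        rw [mul_pow, mul_pow, hω]
        ring

end CylinderAverages

section SeminormEquivalence

variable {d : ℕ}

lemma ofReal_mul_le_of_le_on_first_half {T : ℝ} (hT : 0 ≤ T) {P : E d → ℝ≥0∞} (hP : Measurable P)
    (hP_top : ∀ y, P y ≠ ∞) {φ : ℝ → E d → ℝ≥0∞}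
    (hφ : AEMeasurable (Function.uncurry φ) ((volume.restrict (Ioo 0 T)).prod volume))
    {a A : ℝ≥0∞} (ha : ∀ s ∈ Ioo 0 (T / 2), a ≤ A * ∫⁻ y, P y * φ s y) :
    ENNReal.ofReal T * a ≤ 2 * A * ∫⁻ y, P y * ∫⁻ s in Ioo 0 T, φ s y := by
  have hmeas : AEMeasurable (Function.uncurry fun s y => P y * φ s y)
      ((volume.restrict (Ioo 0 T)).prod volume) :=
    (hP.comp measurable_snd).aemeasurable.mul hφ
  have hslice : AEMeasurable (fun s => ∫⁻ y, P y * φ s y) (volume.restrict (Ioo 0 T)) :=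
    hmeas.lintegral_prod_right'
  calc ENNReal.ofReal T * a = 2 * ∫⁻ _ in Ioo 0 (T / 2), a := by
        rw [setLIntegral_const, Real.volume_Ioo, sub_zero, mul_comm a, ← mul_assoc,
          ← ENNReal.ofReal_ofNat 2, ← ENNReal.ofReal_mul two_pos.le,
          mul_div_cancel₀ _ two_ne_zero]
    _ ≤ 2 * ∫⁻ s in Ioo 0 (T / 2), A * ∫⁻ y, P y * φ s y := by
        gcongr 2 * ?_
        exact setLIntegral_mono' measurableSet_Ioo ha
    _ ≤ 2 * ∫⁻ s in Ioo 0 T, A * ∫⁻ y, P y * φ s y := by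
        gcongr 2 * ?_
        exact lintegral_mono_set (Ioo_subset_Ioo_right (half_le_self hT))
    _ = 2 * A * ∫⁻ y, P y * ∫⁻ s in Ioo 0 T, φ s y := by
        rw [lintegral_const_mul'' _ hslice, lintegral_lintegral_swap hmeas, mul_assoc]
        simp only [lintegral_const_mul' _ _ (hP_top _)]

lemma exists_mul_le_of_le_lintegral_polyKernel (d : ℕ) : ∃ C : ℝ≥0, ∀ {r : ℝ}, 0 < r →
    ∀ {φ : ℝ → E d → ℝ≥0∞},
    AEMeasurable (Function.uncurry φ) ((volume.restrict (Ioo 0 (r ^ 4))).prod volume) →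
    ∀ {x : E d} {a A N : ℝ≥0∞},
    (∀ s ∈ Ioo 0 (r ^ 4 / 2), a ≤ A * ∫⁻ y, ENNReal.ofReal (polyKernel r (x - y)) * φ s y) →
    (∀ z, ∫⁻ s in Ioo 0 (r ^ 4), ∫⁻ y in Metric.ball z r, φ s y ^ 2 ≤
      N ^ 2 * ENNReal.ofReal r ^ (d + 2)) →
    ENNReal.ofReal r * a ≤ C * A * N := by
  obtain ⟨C, hC⟩ := exists_lintegral_polyKernel_mul_le d
  set ω := volume (Metric.ball (0 : E d) 1)
  have hω : ω ^ (1 / 2 : ℝ) ≠ ∞ :=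
    ENNReal.rpow_ne_top_of_nonneg (by norm_num) measure_ball_lt_top.ne
  refine ⟨2 * C * (ω ^ (1 / 2 : ℝ)).toNNReal, fun {r} hr {φ} hφ {x a A N} ha hN => ?_⟩
  set ρ := ENNReal.ofReal r
  set P : E d → ℝ≥0∞ := fun y => ENNReal.ofReal (polyKernel r (x - y))
  set f : E d → ℝ≥0∞ := fun y => ∫⁻ s in Ioo 0 (r ^ 4), φ s y
  have hP : Measurable P :=
    ((continuous_polyKernel hr).comp (continuous_sub_left x)).measurable.ennreal_ofReal
  have htime : ρ ^ 4 * a ≤ 2 * A * ∫⁻ y, P y * f y := by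
    rw [← ENNReal.ofReal_pow hr.le]
    exact ofReal_mul_le_of_le_on_first_half (by positivity) hP (fun _ => ENNReal.ofReal_ne_top)
      hφ ha
  have hspace : ρ ^ d * ∫⁻ y, P y * f y ≤ C * (N * (ρ ^ (d + 3) * ω ^ (1 / 2 : ℝ))) :=
    hC hr x hφ.lintegral_prod_left' fun z => setLIntegral_cylinder_le hr hφ (hN z)
  refine (ENNReal.mul_le_mul_iff_right (a := ρ ^ (d + 3)) ?_ ?_).1 ?_
  · exact pow_ne_zero _ (ENNReal.ofReal_pos.2 hr).ne'
  · exact ENNReal.pow_ne_top ENNReal.ofReal_ne_top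
  calc ρ ^ (d + 3) * (ρ * a) = ρ ^ d * (ρ ^ 4 * a) := by ring
    _ ≤ ρ ^ d * (2 * A * ∫⁻ y, P y * f y) := by gcongr
    _ = 2 * A * (ρ ^ d * ∫⁻ y, P y * f y) := by ring
    _ ≤ 2 * A * (C * (N * (ρ ^ (d + 3) * ω ^ (1 / 2 : ℝ)))) := by gcongr
    _ = ρ ^ (d + 3) * (((2 * C * (ω ^ (1 / 2 : ℝ)).toNNReal : ℝ≥0) : ℝ≥0∞) * A * N) := by
        rw [ENNReal.coe_mul, ENNReal.coe_mul, ENNReal.coe_toNNReal hω, ENNReal.coe_ofNat]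
        ring

lemma WeightIntegrable.aemeasurable_enorm_fderiv_extension {k : E d → ℝ}
    (hk : WeightIntegrable k) (b : ℝ) :
    AEMeasurable (Function.uncurry fun s y => ‖fderiv ℝ (extension k s) y‖ₑ)
      ((volume.restrict (Ioo 0 b)).prod volume) := by
  rw [← Measure.restrict_univ (μ := (volume : Measure (E d))), Measure.prod_restrict]
  exact ((hk.continuousOn_fderiv_extension.mono (prod_mono_left Ioo_subset_Ioi_self)).aemeasurable
    (measurableSet_Ioo.prod .univ)).enorm

lemma WeightIntegrable.enorm_fderiv_extension_add_le {k : E d → ℝ} (hk : WeightIntegrable k)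
    {s t : ℝ} (hs : 0 < s) (ht : 0 < t) (x : E d) {P : E d → ℝ}
    (hP : ∀ z, |green d s z| ≤ P z) : ‖fderiv ℝ (extension k (s + t)) x‖ₑ ≤
      ∫⁻ y, ENNReal.ofReal (P (x - y)) * ‖fderiv ℝ (extension k t) y‖ₑ := by
  rw [hk.fderiv_extension_add hs ht]
  refine (enorm_integral_le_lintegral_enorm _).trans ?_
  rw [← lintegral_sub_left_eq_self _ x]
  refine lintegral_mono fun y => ?_
  rw [sub_sub_cancel, enorm_smul, Real.enorm_eq_ofReal_abs]
  gcongr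
  exact hP _

lemma lintegral_gradient_sq_le_of_energy_le {h : ℝ → E d → ℝ} {z : E d} {r : ℝ} (hr : 0 < r)
    {N : ℝ≥0∞} (hN : energy h z r ≤ N ^ 2) :
    ∫⁻ s in Ioo 0 (r ^ 4), ∫⁻ y in Metric.ball z r, ‖fderiv ℝ (h s) y‖ₑ ^ 2 ≤
      N ^ 2 * ENNReal.ofReal r ^ (d + 2) := by
  rw [energy, ENNReal.div_le_iff_le_mul (.inl (ENNReal.ofReal_pos.2 (by positivity)).ne')
    (.inl ENNReal.ofReal_ne_top), ENNReal.ofReal_pow hr.le] at hN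
  simpa only [enorm_gradient] using hN

lemma exists_enorm_fderiv_extension_le (d : ℕ) : ∃ C : ℝ≥0, 0 < C ∧
    ∀ {k : E d → ℝ}, WeightIntegrable k → ∀ {r : ℝ}, 0 < r → ∀ {N : ℝ≥0∞},
      (∀ z, energy (extension k) z r ≤ N ^ 2) →
      ∀ x, ENNReal.ofReal r * ‖fderiv ℝ (extension k (r ^ 4)) x‖ₑ ≤ C * N := by
  obtain ⟨A, hA, hgreen⟩ := exists_abs_green_le_polyKernel_of_mem_Icc d
  obtain ⟨C, hC⟩ := exists_mul_le_of_le_lintegral_polyKernel d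
  refine ⟨C * A.toNNReal + 1, by positivity, fun {k} hk {r} hr {N} hN x => ?_⟩
  have hgrad : ∀ s ∈ Ioo 0 (r ^ 4 / 2), ‖fderiv ℝ (extension k (r ^ 4)) x‖ₑ ≤
      ENNReal.ofReal A * ∫⁻ y, ENNReal.ofReal (polyKernel r (x - y)) *
        ‖fderiv ℝ (extension k s) y‖ₑ := by
    intro s hs
    have hs_le : s ≤ r ^ 4 / 2 := hs.2.le
    have h := hk.enorm_fderiv_extension_add_le (s := r ^ 4 - s) (by linarith [hs.1, hs.2]) hs.1 x
      (hgreen hr (r ^ 4 - s) ⟨by linarith, by linarith [hs.1]⟩)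
    simpa only [sub_add_cancel, ENNReal.ofReal_mul hA.le, mul_assoc,
      lintegral_const_mul' _ _ ENNReal.ofReal_ne_top] using h
  refine (hC hr (hk.aemeasurable_enorm_fderiv_extension _) hgrad fun z =>
    lintegral_gradient_sq_le_of_energy_le hr (hN z)).trans ?_
  rw [ENNReal.coe_add, ENNReal.coe_mul]
  gcongr
  exact le_self_add

lemma exists_weightedGrad_extension_le (d : ℕ) : ∃ C : ℝ≥0, 0 < C ∧
    ∀ {k : E d → ℝ}, WeightIntegrable k → ∀ {t : ℝ}, 0 < t → ∀ {N : ℝ≥0∞},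
      (∀ z, energy (extension k) z (t ^ (1 / 4 : ℝ)) ≤ N ^ 2) →
      weightedGrad (extension k) t ≤ C * N := by
  obtain ⟨C, hC_pos, hC⟩ := exists_enorm_fderiv_extension_le d
  refine ⟨C, hC_pos, fun {k} hk {t} ht {N} hN => weightedGrad_le_iff.2 (.of_forall fun x => ?_)⟩
  simpa only [rpow_quarter_pow_four ht.le] using hC hk (Real.rpow_pos_of_pos ht _) hN x

lemma exists_normB_equiv_normB0 (hd : 1 ≤ d) : ∃ c₁ c₂ : ℝ≥0, 0 < c₁ ∧ 0 < c₂ ∧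
    ∀ k : E d → ℝ, HasExtension k →
      ((c₁ : ℝ≥0∞) * normB k ≤ normB0 k ∧ normB0 k ≤ (c₂ : ℝ≥0∞) * normB k) ∧
      ∀ R : ℝ, 0 < R →
        (c₁ : ℝ≥0∞) * normBLoc R k ≤ normB0Loc R k ∧
          normB0Loc R k ≤ (c₂ : ℝ≥0∞) * normBLoc R k := by
  obtain ⟨C, hC, hlower⟩ := exists_weightedGrad_extension_le d
  obtain ⟨c₂, hc₂, hupper⟩ := exists_normX0_le_normX d
  have hinv : ∀ {a b : ℝ≥0∞}, a ≤ C * b → ((C⁻¹ : ℝ≥0) : ℝ≥0∞) * a ≤ b := by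
    intro a b hab
    rw [ENNReal.coe_inv hC.ne', mul_comm, ← div_eq_mul_inv]
    exact ENNReal.div_le_of_le_mul' hab
  refine ⟨C⁻¹, c₂, inv_pos.2 hC, hc₂, fun k hk => ⟨⟨hinv ?_, (hupper _).1⟩,
    fun R hR => ⟨hinv ?_, (hupper _).2 R⟩⟩⟩
  · refine iSup₂_le fun t ht => hlower (hk.weightIntegrable hd) ht fun z => ?_
    exact normX0_le_iff.1 le_rfl z _ (Real.rpow_pos_of_pos ht _)
  · refine iSup₂_le fun t ht => hlower (hk.weightIntegrable hd) ht.1 fun z => ?_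
    refine normX0Loc_le_iff.1 le_rfl z _ ⟨Real.rpow_pos_of_pos ht.1 _, ?_⟩
    exact le_of_pow_le_pow_left₀ four_ne_zero hR.le
      ((rpow_quarter_pow_four ht.1.le).trans_le ht.2)

end SeminormEquivalence

section BoundedMeanOscillation

variable {d : ℕ}

lemma normBMO_le_iff {k : E d → ℝ} {N : ℝ≥0∞} :
    normBMO k ≤ N ↔ ∀ (x : E d) (r : ℝ), 0 < r →
      ∫⁻ y in Metric.ball x r, ‖k y - ⨍ z in Metric.ball x r, k z‖ₑ ≤
        N * volume (Metric.ball x r) := by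
  simp only [normBMO, iSup_le_iff]
  exact forall₃_congr fun x r hr => ENNReal.div_le_iff_le_mul
    (.inl (Metric.measure_ball_pos _ _ hr).ne') (.inl measure_ball_lt_top.ne)

lemma enorm_average_sub_average_double_le {k : E d → ℝ} (hk : LocallyIntegrable k) (x : E d)
    {r : ℝ} (hr : 0 < r) :
    ‖(⨍ z in Metric.ball x (2 * r), k z) - ⨍ z in Metric.ball x r, k z‖ₑ ≤
      (1 + 2 ^ d) * normBMO k := by
  have hosc := normBMO_le_iff.1 (le_refl (normBMO k)) x
  have hosc_r := hosc r hr
  have hosc_two := hosc (2 * r) (by positivity)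
  set a := ⨍ z in Metric.ball x r, k z
  set b := ⨍ z in Metric.ball x (2 * r), k z
  have hvol : volume (Metric.ball x (2 * r)) = 2 ^ d * volume (Metric.ball x r) := by
    rw [volume_ball_eq_ofReal_pow_mul x hr, volume_ball_eq_ofReal_pow_mul x (by positivity),
      ENNReal.ofReal_mul two_pos.le, ENNReal.ofReal_ofNat, mul_pow, mul_assoc]
  have hmeas : AEMeasurable (fun y => ‖k y - a‖ₑ) (volume.restrict (Metric.ball x r)) :=
    (hk.aestronglyMeasurable.aemeasurable.sub_const a).enorm.restrict
  refine (ENNReal.mul_le_mul_iff_left (Metric.measure_ball_pos volume x hr).ne'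
    measure_ball_lt_top.ne).1 ?_
  calc ‖b - a‖ₑ * volume (Metric.ball x r) = ∫⁻ _ in Metric.ball x r, ‖b - a‖ₑ := by
        rw [setLIntegral_const]
    _ ≤ ∫⁻ y in Metric.ball x r, (‖k y - a‖ₑ + ‖k y - b‖ₑ) := by
        refine lintegral_mono fun y => ?_
        rw [← sub_sub_sub_cancel_left a b (k y)]
        exact enorm_sub_le
    _ = (∫⁻ y in Metric.ball x r, ‖k y - a‖ₑ) + ∫⁻ y in Metric.ball x r, ‖k y - b‖ₑ :=
        lintegral_add_left' hmeas _
    _ ≤ normBMO k * volume (Metric.ball x r) +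
          normBMO k * volume (Metric.ball x (2 * r)) := by
        gcongr
        refine (lintegral_mono_set (Metric.ball_subset_ball ?_)).trans hosc_two
        linarith
    _ = (1 + 2 ^ d) * normBMO k * volume (Metric.ball x r) := by
        rw [hvol]
        ring

lemma enorm_average_sub_average_two_pow_le {k : E d → ℝ} (hk : LocallyIntegrable k) (x : E d)
    {r : ℝ} (hr : 0 < r) (j : ℕ) :
    ‖(⨍ z in Metric.ball x (2 ^ j * r), k z) - ⨍ z in Metric.ball x r, k z‖ₑ ≤
      j * (1 + 2 ^ d) * normBMO k := by
  induction j with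
  | zero => simp
  | succ j ih =>
    have hdouble := enorm_average_sub_average_double_le hk x (r := 2 ^ j * r) (by positivity)
    rw [← mul_assoc, ← pow_succ'] at hdouble
    rw [← sub_add_sub_cancel _ (⨍ z in Metric.ball x (2 ^ j * r), k z)]
    refine (enorm_add_le _ _).trans ((add_le_add hdouble ih).trans_eq ?_)
    push_cast
    ring

lemma setLIntegral_two_pow_oscillation_le {k : E d → ℝ} (hk : LocallyIntegrable k) (x : E d)
    {r : ℝ} (hr : 0 < r) (j : ℕ) :
    ∫⁻ y in Metric.ball x (2 ^ j * r), ‖k y - ⨍ z in Metric.ball x r, k z‖ₑ ≤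
      (1 + j * (1 + 2 ^ d)) * normBMO k * volume (Metric.ball x (2 ^ j * r)) := by
  have hosc := normBMO_le_iff.1 (le_refl (normBMO k)) x (2 ^ j * r) (by positivity)
  have hmeans := enorm_average_sub_average_two_pow_le hk x hr j
  set a := ⨍ z in Metric.ball x r, k z
  set b := ⨍ z in Metric.ball x (2 ^ j * r), k z
  calc ∫⁻ y in Metric.ball x (2 ^ j * r), ‖k y - a‖ₑ
      ≤ ∫⁻ y in Metric.ball x (2 ^ j * r), (‖k y - b‖ₑ + ‖b - a‖ₑ) := by
        refine lintegral_mono fun y => ?_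
        rw [← sub_add_sub_cancel (k y) b a]
        exact enorm_add_le _ _
    _ = (∫⁻ y in Metric.ball x (2 ^ j * r), ‖k y - b‖ₑ) +
          ‖b - a‖ₑ * volume (Metric.ball x (2 ^ j * r)) := by
        rw [lintegral_add_right _ measurable_const, setLIntegral_const]
    _ ≤ normBMO k * volume (Metric.ball x (2 ^ j * r)) +
          j * (1 + 2 ^ d) * normBMO k * volume (Metric.ball x (2 ^ j * r)) := by gcongr
    _ = (1 + j * (1 + 2 ^ d)) * normBMO k * volume (Metric.ball x (2 ^ j * r)) := by ring

lemma exists_mem_ball_and_polyKernel_le {r : ℝ} (hr : 0 < r) (x y : E d) :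
    ∃ j : ℕ, y ∈ Metric.ball x (2 ^ (j + 1) * r) ∧
      polyKernel r (x - y) ≤ (r ^ d)⁻¹ * ((2 ^ j) ^ (d + 1))⁻¹ := by
  obtain ⟨j, hj, hj'⟩ := exists_nat_pow_near (x := 1 + ‖x - y‖ / r)
    (le_add_of_nonneg_right (by positivity)) one_lt_two
  refine ⟨j, ?_, by unfold polyKernel; gcongr⟩
  rw [Metric.mem_ball, dist_comm, dist_eq_norm, ← div_lt_iff₀ hr]
  linarith

lemma lintegral_polyKernel_mul_le_tsum {r : ℝ} (hr : 0 < r) (x : E d) {f : E d → ℝ≥0∞}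
    (hf : AEMeasurable f) :
    ∫⁻ y, ENNReal.ofReal (polyKernel r (x - y)) * f y ≤
      ∑' j : ℕ, ENNReal.ofReal ((r ^ d)⁻¹ * ((2 ^ j) ^ (d + 1))⁻¹) *
        ∫⁻ y in Metric.ball x (2 ^ (j + 1) * r), f y := by
  calc ∫⁻ y, ENNReal.ofReal (polyKernel r (x - y)) * f y
      ≤ ∫⁻ y, ∑' j : ℕ, ENNReal.ofReal ((r ^ d)⁻¹ * ((2 ^ j) ^ (d + 1))⁻¹) *
          (Metric.ball x (2 ^ (j + 1) * r)).indicator f y := by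
        refine lintegral_mono fun y => ?_
        obtain ⟨j, hmem, hle⟩ := exists_mem_ball_and_polyKernel_le hr x y
        refine le_trans ?_ (ENNReal.le_tsum j)
        rw [indicator_of_mem hmem]
        gcongr
    _ = _ := by
        rw [lintegral_tsum fun j => (hf.indicator measurableSet_ball).const_mul _]
        simp only [lintegral_const_mul' _ _ ENNReal.ofReal_ne_top,
          lintegral_indicator measurableSet_ball]

lemma tsum_mul_inv_two_pow_ne_top (b : ℝ≥0) :
    ∑' j : ℕ, ((1 + (j + 1) * b : ℝ≥0) : ℝ≥0∞) * ((2⁻¹ ^ j : ℝ≥0) : ℝ≥0∞) ≠ ∞ := by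
  have hgeom : Summable fun j : ℕ => (2⁻¹ : ℝ) ^ j :=
    summable_geometric_of_lt_one (by norm_num) (by norm_num)
  have harith : Summable fun j : ℕ => (j : ℝ) ^ 1 * (2⁻¹ : ℝ) ^ j :=
    summable_pow_mul_geometric_of_norm_lt_one 1 (by norm_num)
  simp only [← ENNReal.coe_mul]
  rw [ENNReal.tsum_coe_ne_top_iff_summable, ← NNReal.summable_coe]
  refine ((hgeom.mul_left (1 + (b : ℝ))).add (harith.mul_left (b : ℝ))).congr fun j => ?_
  push_cast
  ring

lemma exists_lintegral_polyKernel_mul_oscillation_le (d : ℕ) : ∃ C : ℝ≥0,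
    ∀ {k : E d → ℝ}, LocallyIntegrable k → ∀ (x : E d) {r : ℝ}, 0 < r →
      ∫⁻ y, ENNReal.ofReal (polyKernel r (x - y)) * ‖k y - ⨍ z in Metric.ball x r, k z‖ₑ ≤
        C * normBMO k := by
  set ω := volume (Metric.ball (0 : E d) 1)
  set S : ℝ≥0∞ :=
    ∑' j : ℕ, ((1 + (j + 1) * (1 + 2 ^ d) : ℝ≥0) : ℝ≥0∞) * ((2⁻¹ ^ j : ℝ≥0) : ℝ≥0∞)
  have hC : S * (2 ^ d * ω) ≠ ∞ := ENNReal.mul_ne_top (tsum_mul_inv_two_pow_ne_top _)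
    (ENNReal.mul_ne_top (by finiteness) measure_ball_lt_top.ne)
  refine ⟨(S * (2 ^ d * ω)).toNNReal, fun {k} hk x {r} hr => ?_⟩
  rw [ENNReal.coe_toNNReal hC, mul_assoc, ← ENNReal.tsum_mul_right]
  refine (lintegral_polyKernel_mul_le_tsum hr x
    (hk.aestronglyMeasurable.aemeasurable.sub_const _).enorm).trans
    (ENNReal.tsum_le_tsum fun j => ?_)
  have hscale : ENNReal.ofReal ((r ^ d)⁻¹ * ((2 ^ j) ^ (d + 1))⁻¹) *
      ENNReal.ofReal (2 ^ (j + 1) * r) ^ d = ((2⁻¹ ^ j : ℝ≥0) : ℝ≥0∞) * 2 ^ d := by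
    rw [← ENNReal.ofReal_pow (by positivity), ← ENNReal.ofReal_mul (by positivity),
      ← ENNReal.ofReal_coe_nnreal, ← ENNReal.ofReal_ofNat 2, ← ENNReal.ofReal_pow two_pos.le,
      ← ENNReal.ofReal_mul (by positivity)]
    congr 1
    push_cast
    rw [inv_pow, mul_pow, pow_succ (2 : ℝ) j, mul_pow, pow_succ (2 ^ j : ℝ)]
    field_simp
  calc _ ≤ ENNReal.ofReal ((r ^ d)⁻¹ * ((2 ^ j) ^ (d + 1))⁻¹) *
        ((1 + (j + 1 : ℕ) * (1 + 2 ^ d)) * normBMO k *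
          (ENNReal.ofReal (2 ^ (j + 1) * r) ^ d * ω)) := by
        gcongr
        rw [← volume_ball_eq_ofReal_pow_mul x (by positivity)]
        exact setLIntegral_two_pow_oscillation_le hk x hr (j + 1)
    _ = (1 + (j + 1 : ℕ) * (1 + 2 ^ d)) * (ENNReal.ofReal ((r ^ d)⁻¹ * ((2 ^ j) ^ (d + 1))⁻¹) *
          ENNReal.ofReal (2 ^ (j + 1) * r) ^ d) * (ω * normBMO k) := by ring
    _ = _ := by
        rw [hscale]
        push_cast
        ring

lemma MemBMO.weightIntegrable {k : E d → ℝ} (hk : MemBMO k) : WeightIntegrable k := by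
  intro c hc
  obtain ⟨C, hC, hweight⟩ := exists_weight_le_pow (V := E d) hc (d + 1)
  obtain ⟨C', hosc⟩ := exists_lintegral_polyKernel_mul_oscillation_le d
  specialize hosc hk.1 0 one_pos
  set a := ⨍ z in Metric.ball (0 : E d) 1, k z
  have hsub : Integrable fun y => weight c y * (k y - a) := by
    refine ⟨(continuous_weight c).aestronglyMeasurable.mul
      (hk.1.aestronglyMeasurable.sub aestronglyMeasurable_const), ?_⟩
    calc ∫⁻ y, ‖weight c y * (k y - a)‖ₑ
        ≤ ∫⁻ y, ENNReal.ofReal C * (ENNReal.ofReal (polyKernel 1 (0 - y)) * ‖k y - a‖ₑ) := by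
          refine lintegral_mono fun y => ?_
          rw [enorm_mul, ← mul_assoc, ← ENNReal.ofReal_mul hC.le,
            Real.enorm_of_nonneg (weight_pos c y).le]
          gcongr
          simpa [polyKernel] using hweight y
      _ ≤ ENNReal.ofReal C * (C' * normBMO k) := by
          rw [lintegral_const_mul' _ _ ENNReal.ofReal_ne_top]
          gcongr
      _ < ∞ := ENNReal.mul_lt_top ENNReal.ofReal_lt_top
          (ENNReal.mul_lt_top ENNReal.coe_lt_top hk.2)
  refine (hsub.add ((integrable_weight hc).mul_const a)).congr (.of_forall fun y => ?_)
  simp only [Pi.add_apply]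
  ring

lemma WeightIntegrable.fderiv_extension_eq_integral_sub {k : E d → ℝ} (hk : WeightIntegrable k)
    {t : ℝ} (ht : 0 < t) (x : E d) (a : ℝ) :
    fderiv ℝ (extension k t) x = ∫ y, (k y - a) • fderiv ℝ (green d t) (x - y) := by
  obtain ⟨B, hB, hle⟩ := hk.exists_eventually_norm_smul_fderiv_green_le ht x
  have hint : Integrable fun y => k y • fderiv ℝ (green d t) (x - y) :=
    hB.mono' (hk.aestronglyMeasurable_smul_fderiv_green ht x) (.of_forall hle.self_of_nhds)
  have hconst : Integrable fun y => a • fderiv ℝ (green d t) (x - y) :=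
    ((integrable_fderiv_green ht).comp_sub_left x).smul a
  simp only [sub_smul]
  rw [integral_sub hint hconst, integral_smul, integral_sub_left_eq_self (fderiv ℝ (green d t)),
    integral_fderiv_green ht, smul_zero, sub_zero, hk.fderiv_extension ht]

lemma exists_normB_le_normBMO (d : ℕ) : ∃ C : ℝ≥0, ∀ k : E d → ℝ, MemBMO k →
    normB k ≤ C * normBMO k := by
  obtain ⟨A, hA, hgreen⟩ := exists_green_le_polyKernel d
  obtain ⟨C, hosc⟩ := exists_lintegral_polyKernel_mul_oscillation_le d
  refine ⟨A.toNNReal * C, fun k hk => iSup₂_le fun t ht => weightedGrad_le_iff.2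
    (.of_forall fun x => ?_)⟩
  set r := t ^ (1 / 4 : ℝ)
  have hr : 0 < r := Real.rpow_pos_of_pos ht _
  have hrt : r ^ 4 = t := rpow_quarter_pow_four ht.le
  specialize hosc hk.1 x hr
  set a := ⨍ z in Metric.ball x r, k z
  calc ENNReal.ofReal r * ‖fderiv ℝ (extension k t) x‖ₑ
      ≤ ENNReal.ofReal r * ∫⁻ y, ‖(k y - a) • fderiv ℝ (green d t) (x - y)‖ₑ := by
        rw [hk.weightIntegrable.fderiv_extension_eq_integral_sub ht x a]
        gcongr
        exact enorm_integral_le_lintegral_enorm _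
    _ = ∫⁻ y, ENNReal.ofReal (r * ‖fderiv ℝ (green d t) (x - y)‖) * ‖k y - a‖ₑ := by
        rw [← lintegral_const_mul' _ _ ENNReal.ofReal_ne_top]
        simp only [enorm_smul, ENNReal.ofReal_mul hr.le, ofReal_norm, mul_assoc,
          mul_comm ‖k _ - a‖ₑ]
    _ ≤ ∫⁻ y, ENNReal.ofReal A * (ENNReal.ofReal (polyKernel r (x - y)) * ‖k y - a‖ₑ) := by
        refine lintegral_mono fun y => ?_
        rw [← mul_assoc, ← ENNReal.ofReal_mul hA.le]
        gcongr ENNReal.ofReal ?_ * _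
        simpa only [hrt] using (hgreen hr (x - y)).2
    _ ≤ ENNReal.ofReal A * (C * normBMO k) := by
        rw [lintegral_const_mul' _ _ ENNReal.ofReal_ne_top]
        gcongr
    _ = ((A.toNNReal * C : ℝ≥0) : ℝ≥0∞) * normBMO k := by
        rw [ENNReal.coe_mul, mul_assoc]
        rfl

lemma exists_normB0_le_normBMO (d : ℕ) : ∃ c : ℝ≥0, 0 < c ∧ ∀ k : E d → ℝ,
    LocallyIntegrable k → normB0 k ≤ c * normBMO k := by
  obtain ⟨C, hC⟩ := exists_normB_le_normBMO d
  obtain ⟨c, hc, hupper⟩ := exists_normX0_le_normX d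
  refine ⟨c * (C + 1), by positivity, fun k hk => ?_⟩
  rcases eq_or_ne (normBMO k) ∞ with htop | hfin
  · rw [htop, ENNReal.mul_top (by positivity)]
    exact le_top
  · calc normB0 k ≤ c * normB k := (hupper _).1
      _ ≤ c * (C * normBMO k) := by
          gcongr
          exact hC k ⟨hk, hfin.lt_top⟩
      _ ≤ (c * (C + 1) : ℝ≥0) * normBMO k := by
          rw [← mul_assoc, ← ENNReal.coe_mul]
          gcongr
          exact le_self_add

lemma MemBMO.memB0 {k : E d → ℝ} (hk : MemBMO k) : MemB0 k := by
  have hw := hk.weightIntegrable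
  obtain ⟨c, -, hc⟩ := exists_normB0_le_normBMO d
  refine ⟨hw.hasExtension, fun t ht x => (hw.hasFDerivAt_extension ht x).differentiableAt, ?_,
    (hc k hk.1).trans_lt (ENNReal.mul_lt_top ENNReal.coe_lt_top hk.2)⟩
  refine ContinuousOn.locallyIntegrableOn ?_ (measurableSet_Ioi.prod .univ)
  simp only [gradient, LinearIsometryEquiv.norm_map]
  exact hw.continuousOn_fderiv_extension.norm.pow 2

lemma memBMO_of_memLp_top {k : E d → ℝ} (hk : MemLp k ∞ volume) : MemBMO k := by
  have hbound : ∀ᵐ y, ‖k y‖ₑ ≤ eLpNorm k ∞ volume := by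
    rw [eLpNorm_exponent_top]
    exact ae_le_eLpNormEssSup
  have hnorm : normBMO k ≤ eLpNorm k ∞ volume + eLpNorm k ∞ volume := by
    refine normBMO_le_iff.2 fun x r hr => ?_
    have haverage : ‖⨍ z in Metric.ball x r, k z‖ₑ ≤ eLpNorm k ∞ volume :=
      calc ‖⨍ z in Metric.ball x r, k z‖ₑ ≤ ⨍⁻ z in Metric.ball x r, ‖k z‖ₑ ∂volume :=
            enorm_integral_le_lintegral_enorm _
        _ ≤ ⨍⁻ _ in Metric.ball x r, eLpNorm k ∞ volume ∂volume :=
            laverage_mono_ae (ae_restrict_of_ae hbound)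
        _ = eLpNorm k ∞ volume :=
            setLAverage_const (Metric.measure_ball_pos _ _ hr).ne' measure_ball_lt_top.ne _
    rw [← setLIntegral_const]
    refine lintegral_mono_ae (ae_restrict_of_ae (hbound.mono fun y hy => ?_))
    exact enorm_sub_le.trans (add_le_add hy haverage)
  exact ⟨hk.locallyIntegrable le_top, hnorm.trans_lt (ENNReal.add_lt_top.2 ⟨hk.2, hk.2⟩)⟩

end BoundedMeanOscillation

end Bicaloric

end

theorem proposition2p2_general (d : ℕ) (hd : 1 ≤ d) :
    (∃ c₁ c₂ : ℝ≥0, 0 < c₁ ∧ 0 < c₂ ∧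
      ∀ k : Bicaloric.E d → ℝ, Bicaloric.HasExtension k →
        ((c₁ : ℝ≥0∞) * Bicaloric.normB k ≤ Bicaloric.normB0 k ∧
          Bicaloric.normB0 k ≤ (c₂ : ℝ≥0∞) * Bicaloric.normB k) ∧
        ∀ R : ℝ, 0 < R →
          (c₁ : ℝ≥0∞) * Bicaloric.normBLoc R k ≤ Bicaloric.normB0Loc R k ∧
            Bicaloric.normB0Loc R k ≤ (c₂ : ℝ≥0∞) * Bicaloric.normBLoc R k) ∧
    (∃ c₃ : ℝ≥0, 0 < c₃ ∧
      ∀ k : Bicaloric.E d → ℝ, LocallyIntegrable k →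
        Bicaloric.normB0 k ≤ (c₃ : ℝ≥0∞) * Bicaloric.normBMO k) ∧
    (∀ k : Bicaloric.E d → ℝ, Bicaloric.MemBMO k → Bicaloric.MemB0 k) ∧
    (∀ k : Bicaloric.E d → ℝ, MemLp k ∞ volume → Bicaloric.MemB0 k) :=
  ⟨Bicaloric.exists_normB_equiv_normB0 hd, Bicaloric.exists_normB0_le_normBMO d,
    fun _ hk => hk.memB0, fun _ hk => (Bicaloric.memBMO_of_memLp_top hk).memB0⟩

theorem proposition2p2 (d : ℕ) (hd : 1 ≤ d) :
    (d ≤ 3 → ∃ c₁ c₂ : ℝ≥0, 0 < c₁ ∧ 0 < c₂ ∧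
      ∀ k : Bicaloric.E d → ℝ, Bicaloric.HasExtension k →
        ((c₁ : ℝ≥0∞) * Bicaloric.normB k ≤ Bicaloric.normB0 k ∧
          Bicaloric.normB0 k ≤ (c₂ : ℝ≥0∞) * Bicaloric.normB k) ∧
        ∀ R : ℝ, 0 < R →
          (c₁ : ℝ≥0∞) * Bicaloric.normBLoc R k ≤ Bicaloric.normB0Loc R k ∧
            Bicaloric.normB0Loc R k ≤ (c₂ : ℝ≥0∞) * Bicaloric.normBLoc R k) ∧
    (∃ c₃ : ℝ≥0, 0 < c₃ ∧
      ∀ k : Bicaloric.E d → ℝ, LocallyIntegrable k →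
        Bicaloric.normB0 k ≤ (c₃ : ℝ≥0∞) * Bicaloric.normBMO k) ∧
    (∀ k : Bicaloric.E d → ℝ, Bicaloric.MemBMO k → Bicaloric.MemB0 k) ∧
    (∀ k : Bicaloric.E d → ℝ, MemLp k ∞ volume → Bicaloric.MemB0 k) :=
  (proposition2p2_general d hd).imp_left fun h _ => h
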